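/- \textbf{Definitions.} Write $\mathbb{C}_+=\{z\in\mathbb{C}:\operatorname{Re}z>0\}$. A \emph{Bernstein function} is a $C^\infty$ function $g:(0,\infty)\to[0,\infty)$ with $(-1)^n g^{(n)}\le 0$ for all $n\ge 1$; it is identified with its unique holomorphic extension to $\mathbb{C}_+$. Every Bernstein function has a unique representation \[ g(z)=a+bz+\int_{(0,\infty)}(1-e^{-sz})\,\mu(ds)\qquad(z>0) \] with $a,b\ge 0$ and a positive Radon measure $\mu$ on $(0,\infty)$ satisfying $\int\frac{s}{1+s}\,\mu(ds)<\infty$. The associated rate function is \[ r[g](t)=\frac a2+\frac bt+\int_{(0,\infty)}\min\Big(\frac st,1\Big)\,\mu(ds)\qquad(t>0). \] A Bernstein function $g\neq 0$ is \emph{special} if $z/g(z)$ is also a Bernstein function. Let $-A$ be the generator of a bounded $C_0$-semigroup $(T(s))_{s\ge 0}$ on a complex Banach space $X$, let $\sigma(A)$ be the spectrum of $A$, and let $C_t(A)x=\frac1t\int_0^tT(s)x\,ds$ for $t>0$, $x\in X$. For a bounded complex Radon measure $\nu$ on $[0,\infty)$ with Laplace transform $e(z)=\int_{[0,\infty)}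 e^{-sz}\,\nu(ds)$ put $e(A)x=\int_{[0,\infty)} T(s)x\,\nu(ds)$. For a holomorphic function $f$ on $\mathbb{C}_+$ define $f(A)=e(A)^{-1}(ef)(A)$ with its natural domain, where $e$ is such that $e$ and $ef$ are Laplace transforms of bounded complex Radon measures on $[0,\infty)$ and $e(A)$ is injective; this does not depend on $e$, and such an $e$ exists for every Bernstein function $f$. Write $\operatorname{ran}(f(A))$ for the range of $f(A)$. \textbf{Theorem.} Let $g$ be a special Bernstein function with associated rate function $r=r[g]$ such that $t\,r(t)\to\infty$ as $t\to\infty$. Let $-A$ be the generator of a bounded $C_0$-semigroup on a complex Banach space $X$ such that $0$ is an accumulation point of $\sigma(A)$. Then for every decreasing (not necessarily strictly) function $\varepsilon:(0,\infty)\to(0,\infty)$ with $\lim_{t\to\infty}\varepsilon(t)=0$ there exists $y\in\operatorname{ran}(g(A))$ such that \[ \sup_{t\ge 1}\frac{\|C_t(A)y\|}{\varepsilon(t)\,r(t)}=\infty . \] -/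

import Mathlib

open Filter Topology MeasureTheory
open scoped NNReal ENNReal

noncomputable section

/-! ### Bernstein functions and their rate functions -/

/-- A function `g` on the open right half-plane is a Bernstein function if it is the holomorphic
extension of a smooth function `(0, ∞) → [0, ∞)` all of whose derivatives alternate in sign:
`(-1)ⁿ g⁽ⁿ⁾ ≤ 0` for `n ≥ 1`.  (Values of `g` outside the open right half-plane play no role.) -/
structure IsBernstein (g : ℂ → ℂ) : Prop where
  holomorphic : DifferentiableOn ℂ g {z : ℂ | 0 < z.re}
  real : ∀ t : ℝ, 0 < t → (g (t : ℂ)).im = 0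
  smooth : ContDiffOn ℝ (⊤ : ℕ∞) (fun s : ℝ => (g (s : ℂ)).re) (Set.Ioi 0)
  nonneg : ∀ t : ℝ, 0 < t → 0 ≤ (g (t : ℂ)).re
  sign_deriv : ∀ n : ℕ, 1 ≤ n → ∀ t : ℝ, 0 < t →
    (-1 : ℝ) ^ n * iteratedDeriv n (fun s : ℝ => (g (s : ℂ)).re) t ≤ 0

/-- A nonzero Bernstein function `g` is special if `z / g(z)` is again a Bernstein function. -/
structure IsSpecialBernstein (g : ℂ → ℂ) : Prop where
  bernstein : IsBernstein g
  ne_zero : ∃ t : ℝ, 0 < t ∧ g (t : ℂ) ≠ 0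
  bernstein_div : IsBernstein (fun z => z / g z)

/-- `g ∼ (a, b, μ)`: the constants `a, b ≥ 0` and the positive measure `μ` on `(0, ∞)` (realised as
a measure on `ℝ` without mass on `(-∞, 0]`) with `∫ s / (1 + s) μ(ds) < ∞` represent `g` as
`g(t) = a + b t + ∫ (1 - e^{-st}) μ(ds)` for `t > 0`. -/
structure HasLevyTriple (g : ℂ → ℂ) (a b : ℝ) (μ : Measure ℝ) : Prop where
  nonneg_a : 0 ≤ a
  nonneg_b : 0 ≤ b
  null : μ (Set.Iic 0) = 0
  finite : ∫⁻ s, ENNReal.ofReal (s / (1 + s)) ∂μ < ∞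
  repr : ∀ t : ℝ, 0 < t →
    g (t : ℂ) = ((a + b * t + ∫ s, (1 - Real.exp (-(s * t))) ∂μ : ℝ) : ℂ)

/-- The rate `a / 2 + b / t + ∫ min (s / t) 1 μ(ds)` of a triple `(a, b, μ)`. -/
def levyRate (a b : ℝ) (μ : Measure ℝ) (t : ℝ) : ℝ :=
  a / 2 + b / t + ∫ s, min (s / t) 1 ∂μ

open Classical in
/-- The rate function `r[g]` of a Bernstein function `g`: the rate of its representing triple.
Every Bernstein function has exactly one such triple; the value `0` is only a default for functions
that have no representation. -/
def bernsteinRate (g : ℂ → ℂ) (t : ℝ) : ℝ :=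
  if h : ∃ p : ℝ × ℝ × Measure ℝ, HasLevyTriple g p.1 p.2.1 p.2.2 then
    levyRate h.choose.1 h.choose.2.1 h.choose.2.2 t
  else 0

/-! ### Bounded `C₀`-semigroups, generators, spectra -/

section Semigroup

variable {X : Type*} [NormedAddCommGroup X] [NormedSpace ℂ X]

/-- `(T(s))_{s ≥ 0}` is a bounded, strongly continuous one-parameter semigroup on `X`. -/
structure IsBoundedC0Semigroup (T : ℝ≥0 → X →L[ℂ] X) : Prop where
  map_zero : T 0 = ContinuousLinearMap.id ℂ X
  map_add : ∀ s t : ℝ≥0, T (s + t) = (T s).comp (T t)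
  continuous : ∀ x : X, Continuous (fun s => T s x)
  bounded : ∃ M : ℝ, ∀ s : ℝ≥0, ‖T s‖ ≤ M

/-- The graph of `A`, where `-A` is the generator of `T`: the pairs `(x, y)` with
`(x - T(h) x) / h → y` as `h ↓ 0`. -/
def negGeneratorGraph (T : ℝ≥0 → X →L[ℂ] X) : Submodule ℂ (X × X) where
  carrier := {p | Tendsto (fun h : ℝ≥0 => (h : ℝ)⁻¹ • (p.1 - T h p.1)) (𝓝[>] 0) (𝓝 p.2)}
  zero_mem' := by simp
  add_mem' := by
    intro p q hp hq
    refine (Tendsto.add hp hq).congr fun h => ?_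
    simp only [Prod.fst_add, _root_.map_add, ← smul_add]
    congr 1
    abel
  smul_mem' := by
    intro c p hp
    refine (Tendsto.const_smul hp c).congr fun h => ?_
    simp only [Prod.smul_fst, _root_.map_smul, ← smul_sub]
    rw [smul_comm]

/-- The operator `A` such that `-A` is the generator of `T`. -/
def negGenerator (T : ℝ≥0 → X →L[ℂ] X) : X →ₗ.[ℂ] X :=
  (negGeneratorGraph T).toLinearPMap

/-- The operator `negGenerator T` has the prescribed graph. -/
theorem mem_graph_negGenerator (T : ℝ≥0 → X →L[ℂ] X) (p : X × X) :
    p ∈ (negGenerator T).graph ↔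
      Tendsto (fun h : ℝ≥0 => (h : ℝ)⁻¹ • (p.1 - T h p.1)) (𝓝[>] 0) (𝓝 p.2) := by
  have hg : ∀ x ∈ negGeneratorGraph T, x.fst = 0 → x.snd = 0 := by
    rintro ⟨x, y⟩ hx rfl
    have hx' : Tendsto (fun h : ℝ≥0 => (h : ℝ)⁻¹ • ((0 : X) - T h 0)) (𝓝[>] 0) (𝓝 y) := hx
    simp only [_root_.map_zero, sub_zero, smul_zero] at hx'
    exact (tendsto_nhds_unique hx' tendsto_const_nhds)
  rw [negGenerator, Submodule.toLinearPMap_graph_eq _ hg]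
  rfl

/-- `lam` belongs to the resolvent set of the (possibly unbounded) operator `A`: the operator
`lam - A` on its domain has a bounded everywhere defined two-sided inverse. -/
def IsResolventPoint (A : X →ₗ.[ℂ] X) (lam : ℂ) : Prop :=
  ∃ R : X →L[ℂ] X,
    (∀ x : X, ∃ h : R x ∈ A.domain, lam • R x - A ⟨R x, h⟩ = x) ∧
    (∀ x : A.domain, R (lam • (x : X) - A x) = x)

/-- The spectrum `σ(A)` of a (possibly unbounded) operator. -/
def opSpectrum (A : X →ₗ.[ℂ] X) : Set ℂ := {lam | ¬ IsResolventPoint A lam}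

/-- The Cesàro mean `C_t(A) x = (1 / t) ∫_0^t T(s) x ds`. -/
def cesaroMean (T : ℝ≥0 → X →L[ℂ] X) (t : ℝ) (x : X) : X :=
  t⁻¹ • ∫ s in (0 : ℝ)..t, T s.toNNReal x

/-! ### The extended Hille–Phillips calculus -/

/-- The Laplace transform `z ↦ ∫ e^{-sz} μ(ds)` of a bounded complex measure `μ` on `[0, ∞)`. -/
def laplaceTransform (μ : ComplexMeasure ℝ≥0) (z : ℂ) : ℂ :=
  ∫ᵛ s, Complex.exp (-(((s : ℝ) : ℂ) * z)) ∂[ContinuousLinearMap.mul ℝ ℂ; μ]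

/-- The Hille–Phillips calculus: for `f` the Laplace transform of the bounded complex measure `μ`
on `[0, ∞)`, the operator `f(A) x = ∫ T(s) x μ(ds)`. -/
def hillePhillips (T : ℝ≥0 → X →L[ℂ] X) (μ : ComplexMeasure ℝ≥0) (x : X) : X :=
  ∫ᵛ s, T s x ∂[(ContinuousLinearMap.lsmul ℝ ℂ : ℂ →L[ℝ] X →L[ℝ] X).flip; μ]

/-- `e = ν^` regularizes the function `f` on the open right half-plane, with `e f = μ^`: both `ν`
and `μ` are bounded complex measures on `[0, ∞)`, and `e(A)` is injective. -/
structure IsRegularization (T : ℝ≥0 → X →L[ℂ] X) (f : ℂ → ℂ) (ν μ : ComplexMeasure ℝ≥0) :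
    Prop where
  finite_left : IsFiniteMeasure ν.variation
  finite_right : IsFiniteMeasure μ.variation
  laplace_eq : ∀ z : ℂ, 0 < z.re → laplaceTransform μ z = laplaceTransform ν z * f z
  injective : Function.Injective (hillePhillips T ν)

/-- The graph of the operator `f(A) = e(A)⁻¹ (e f)(A)` of the extended Hille–Phillips calculus:
`(x, y)` belongs to it if and only if `(e f)(A) x = e(A) y` for a regularizer `e` of `f`.
(The operator does not depend on the choice of `e`; the graph is empty if no `e` exists.) -/
def extendedHPGraph (T : ℝ≥0 → X →L[ℂ] X) (f : ℂ → ℂ) : Set (X × X) :=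
  {p | ∃ ν μ : ComplexMeasure ℝ≥0,
    IsRegularization T f ν μ ∧ hillePhillips T μ p.1 = hillePhillips T ν p.2}

/-- The range of `f(A)`. -/
def extendedHPRange (T : ℝ≥0 → X →L[ℂ] X) (f : ℂ → ℂ) : Set X :=
  Prod.snd '' extendedHPGraph T f

end Semigroup

end

/-! The proof is a uniform boundedness argument tested against spectral values near 0. The symbol
g(z)/(1+z) is the Laplace transform of a bounded measure b δ₀ + k(r) dr
(`integral_exp_mul_levyKernel`), so it defines a bounded operator G = g(A)(1+A)⁻¹ whose range lies
in ran g(A) (`mem_extendedHPRange`). If no y had the required property, Banach–Steinhaus would give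
‖C_t(A)G‖ ≤ K ε(t) r(t) for all t ≥ 1 with r(t) > 0.

Every λ in σ(A) is an approximate character of the semigroup (`exists_approx_character`), so the
product of the symbols of C_t(A) and G at λ has modulus at most 2‖C_t(A)G‖
(`norm_laplace_mul_laplace_le`). For t = 1/(4|λ|) with λ ≠ 0 small, the Cesàro symbol has modulus at
least 1/2 and |g(λ)| ≥ r(t)/64. Hence r(t) is at most a constant times K ε(t) r(t), which fails once
ε(t) is small.

The lower bound for |g(λ)| is where specialness enters: λ may lie on the imaginary axis, where a
general Bernstein function can even vanish, as 1 - e^{-z} does at 2πi. Every Bernstein function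
satisfies |f(x+iy)| ≤ 4 f(x+|y|) (`IsBernstein.norm_le`). Applied to f = z/g this upper bound turns
into g(|λ|) ≤ 8|g(λ)| (`norm_levyFunction_ge`), and r(1/(4x)) ≤ 8 g(x) is elementary
(`levyRate_le`). -/

/-! ### Integrals against vector measures with a density -/

section VectorMeasureDensity

variable {α E F G : Type*} [MeasurableSpace α]
  [NormedAddCommGroup E] [NormedSpace ℝ E] [NormedAddCommGroup F] [NormedSpace ℝ F]
  [CompleteSpace F] [NormedAddCommGroup G] [NormedSpace ℝ G] [CompleteSpace G]

theorem isFiniteMeasure_variation_withDensityᵥ {P : Measure α} {k : α → F} (hk : Integrable k P) :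
    IsFiniteMeasure (P.withDensityᵥ k).variation := by
  rw [Measure.variation_withDensityᵥ hk]
  exact ⟨by simpa using! hk.2⟩

omit [CompleteSpace F] [CompleteSpace G] in
theorem integrable_bilin_of_bound {P : Measure α} {k : α → F} (hk : Integrable k P)
    (B : E →L[ℝ] F →L[ℝ] G) {f : α → E} (hf : StronglyMeasurable f) {C : ℝ}
    (hC : ∀ x, ‖f x‖ ≤ C) : Integrable (fun x => B (f x) (k x)) P := by
  refine (hk.norm.const_mul (‖B‖ * C)).mono'
    (B.aestronglyMeasurable_comp₂ hf.aestronglyMeasurable hk.1) (.of_forall fun x => ?_)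
  calc ‖B (f x) (k x)‖ ≤ ‖B‖ * ‖f x‖ * ‖k x‖ := B.le_opNorm₂ _ _
    _ ≤ ‖B‖ * C * ‖k x‖ := by gcongr; exact hC x

theorem vectorIntegral_withDensityᵥ_simpleFunc {P : Measure α} {k : α → F} (hk : Integrable k P)
    (B : E →L[ℝ] F →L[ℝ] G) (f : SimpleFunc α E) :
    (P.withDensityᵥ k).integral f B = ∫ x, B (f x) (k x) ∂P := by
  have hfin := isFiniteMeasure_variation_withDensityᵥ hk
  have hint : ∀ f : SimpleFunc α E, Integrable (fun x => B (f x) (k x)) P := fun f => by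
    obtain ⟨C, hC⟩ := f.exists_forall_norm_le
    exact integrable_bilin_of_bound hk B f.stronglyMeasurable hC
  induction f using SimpleFunc.induction with
  | const c hs =>
    rename_i s
    have h1 : (fun x => B ((SimpleFunc.piecewise s hs (SimpleFunc.const α c)
        (SimpleFunc.const α 0)) x) (k x)) = s.indicator (fun x => B c (k x)) := by
      ext x
      by_cases hx : x ∈ s <;> simp [hx]
    rw [h1, integral_indicator hs, ContinuousLinearMap.integral_comp_comm _ hk.integrableOn,
      ← withDensityᵥ_apply hk hs]
    have h2 : (⇑(SimpleFunc.piecewise s hs (SimpleFunc.const α c)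
        (SimpleFunc.const α 0)) : α → E) = s.indicator (fun _ => c) := by
      ext x
      by_cases hx : x ∈ s <;> simp [hx]
    rw [h2]
    exact VectorMeasure.integral_indicator_const _ hs
  | @add f g hd hf hg =>
    have e : (⇑(f + g) : α → E) = fun x => f x + g x := rfl
    rw [e, VectorMeasure.integral_fun_add (f.integrable_of_isFiniteMeasure)
      (g.integrable_of_isFiniteMeasure), hf, hg, ← integral_add (hint f) (hint g)]
    simp

theorem vectorIntegral_withDensityᵥ {P : Measure α} {k : α → F} (hk : Integrable k P)
    (B : E →L[ℝ] F →L[ℝ] G) {f : α → E} (hf : StronglyMeasurable f) {C : ℝ}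
    (hC : ∀ x, ‖f x‖ ≤ C) :
    (P.withDensityᵥ k).integral f B = ∫ x, B (f x) (k x) ∂P := by
  have hfin := isFiniteMeasure_variation_withDensityᵥ hk
  -- A point of `α` is needed to get `0 ≤ C`, which the bounded simple approximations require.
  by_cases hα : Nonempty α
  swap
  · have := not_nonempty_iff.1 hα
    simp [VectorMeasure.integral_of_isEmpty, Measure.eq_zero_of_isEmpty P]
  have hC0 : 0 ≤ C := (norm_nonneg _).trans (hC hα.some)
  have h1 : Tendsto (fun n => (P.withDensityᵥ k).integral (hf.approxBounded C n) B) atTop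
      (𝓝 ((P.withDensityᵥ k).integral f B)) :=
    VectorMeasure.tendsto_integral_of_dominated_convergence (fun _ => C)
      (fun n => (hf.approxBounded C n).stronglyMeasurable.aestronglyMeasurable)
      (integrable_const C) (fun n => .of_forall fun x => hf.norm_approxBounded_le hC0 n x)
      (.of_forall fun x => hf.tendsto_approxBounded_of_norm_le (hC x))
  have h2 : Tendsto (fun n => ∫ x, B (hf.approxBounded C n x) (k x) ∂P) atTop
      (𝓝 (∫ x, B (f x) (k x) ∂P)) := by
    refine tendsto_integral_of_dominated_convergence (fun x => ‖B‖ * C * ‖k x‖)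
      (fun n => (integrable_bilin_of_bound hk B (hf.approxBounded C n).stronglyMeasurable
        (hf.norm_approxBounded_le hC0 n)).1) (hk.norm.const_mul _)
      (fun n => .of_forall fun x => ?_) (.of_forall fun x => ?_)
    · calc _ ≤ ‖B‖ * ‖hf.approxBounded C n x‖ * ‖k x‖ := B.le_opNorm₂ _ _
        _ ≤ ‖B‖ * C * ‖k x‖ := by gcongr; exact hf.norm_approxBounded_le hC0 n x
    · exact ((B.flip (k x)).continuous.tendsto _).comp
        (hf.tendsto_approxBounded_of_norm_le (hC x))
  refine tendsto_nhds_unique h1 (h2.congr fun n => ?_)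
  rw [vectorIntegral_withDensityᵥ_simpleFunc hk]

end VectorMeasureDensity

/-! ### Measures on the half-line consisting of an atom at `0` and a density -/

/-- The complex measure `b δ₀ + k(r) dr` on `[0, ∞)`. -/
noncomputable def kernelMeasure (b : ℂ) (k : ℝ → ℂ) : ComplexMeasure ℝ≥0 :=
  VectorMeasure.dirac 0 b + ((volume.restrict (Set.Ioi 0)).withDensityᵥ k).map Real.toNNReal

theorem isFiniteMeasure_variation_kernelMeasure (b : ℂ) {k : ℝ → ℂ}
    (hk : IntegrableOn k (Set.Ioi 0)) : IsFiniteMeasure (kernelMeasure b k).variation := by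
  have := isFiniteMeasure_variation_withDensityᵥ hk
  exact isFiniteMeasure_of_le
    ((VectorMeasure.dirac (0 : ℝ≥0) b).variation +
      (((volume.restrict (Set.Ioi 0)).withDensityᵥ k).map Real.toNNReal).variation)
    VectorMeasure.variation_add_le

/-- Common source of the formulas for the Laplace transform and for the Hille–Phillips operator:
both become ordinary Bochner integrals over the half-line plus the contribution of the atom. -/
theorem vectorIntegral_kernelMeasure {E G : Type*} [NormedAddCommGroup E] [NormedSpace ℝ E]
    [NormedAddCommGroup G] [NormedSpace ℝ G] [CompleteSpace G]
    (B : E →L[ℝ] ℂ →L[ℝ] G) (b : ℂ) {k : ℝ → ℂ} (hk : IntegrableOn k (Set.Ioi 0))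
    {f : ℝ≥0 → E} (hf : Continuous f) {C : ℝ} (hC : ∀ x, ‖f x‖ ≤ C) :
    (kernelMeasure b k).integral f B =
      B (f 0) b + ∫ r in Set.Ioi (0 : ℝ), B (f r.toNNReal) (k r) := by
  have := isFiniteMeasure_variation_withDensityᵥ hk
  have hfm : StronglyMeasurable f := hf.stronglyMeasurable
  have hfm' : StronglyMeasurable (f ∘ Real.toNNReal) :=
    (hf.comp continuous_real_toNNReal).stronglyMeasurable
  have hi : ∀ ν : Measure ℝ≥0, IsFiniteMeasure ν → Integrable f ν := fun ν _ =>
    Integrable.of_bound hfm.aestronglyMeasurable C (.of_forall hC)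
  have hi' : VectorMeasure.Integrable ((volume.restrict (Set.Ioi 0)).withDensityᵥ k)
      (f ∘ Real.toNNReal) :=
    Integrable.of_bound hfm'.aestronglyMeasurable C (.of_forall fun x => hC _)
  rw [kernelMeasure, VectorMeasure.integral_add_vectorMeasure (hi _ inferInstance)
    (hi _ inferInstance), VectorMeasure.integral_dirac,
    VectorMeasure.integral_map continuous_real_toNNReal.measurable hfm.aestronglyMeasurable hi']
  congr 1
  exact vectorIntegral_withDensityᵥ hk B hfm' (fun x => hC _)

theorem laplaceTransform_kernelMeasure (b : ℂ) {k : ℝ → ℂ} (hk : IntegrableOn k (Set.Ioi 0))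
    {z : ℂ} (hz : 0 ≤ z.re) :
    laplaceTransform (kernelMeasure b k) z =
      b + ∫ r in Set.Ioi (0 : ℝ), Complex.exp (-(r * z)) * k r := by
  rw [laplaceTransform, vectorIntegral_kernelMeasure _ b hk (C := 1) (by fun_prop)]
  · simp only [NNReal.coe_zero, Complex.ofReal_zero, zero_mul, neg_zero, Complex.exp_zero,
      ContinuousLinearMap.mul_apply', one_mul]
    congr 1
    refine setIntegral_congr_fun measurableSet_Ioi fun r hr => ?_
    simp [Real.coe_toNNReal r (le_of_lt hr)]
  · intro s
    rw [Complex.norm_exp]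
    simpa using mul_nonneg s.2 hz

theorem hillePhillips_kernelMeasure {X : Type*} [NormedAddCommGroup X] [NormedSpace ℂ X]
    [CompleteSpace X] {T : ℝ≥0 → X →L[ℂ] X} (hT : IsBoundedC0Semigroup T)
    (b : ℂ) {k : ℝ → ℂ} (hk : IntegrableOn k (Set.Ioi 0)) (x : X) :
    hillePhillips T (kernelMeasure b k) x =
      b • x + ∫ r in Set.Ioi (0 : ℝ), k r • T r.toNNReal x := by
  obtain ⟨M, hM⟩ := hT.bounded
  rw [hillePhillips, vectorIntegral_kernelMeasure _ b hk (C := M * ‖x‖) (hT.continuous x)]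
  · simp [hT.map_zero]
  · exact fun s => (T s).le_of_opNorm_le (hM s) x

/-! ### Growth of Bernstein functions in the right half-plane -/

theorem isOpen_rightHalfPlane : IsOpen {z : ℂ | 0 < z.re} :=
  isOpen_lt continuous_const Complex.continuous_re

namespace IsBernstein

variable {f : ℂ → ℂ}

theorem ofReal_re (hf : IsBernstein f) {s : ℝ} (hs : 0 < s) : ((f s).re : ℂ) = f s :=
  Complex.ext (by simp) (by simp [hf.real s hs])

theorem differentiableOn_iteratedDeriv (hf : IsBernstein f) (n : ℕ) :
    DifferentiableOn ℂ (iteratedDeriv n f) {z : ℂ | 0 < z.re} := by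
  induction n with
  | zero => simpa using hf.holomorphic
  | succ n ih =>
    rw [iteratedDeriv_succ]
    exact ih.deriv isOpen_rightHalfPlane

theorem iteratedDeriv_ofReal (hf : IsBernstein f) (n : ℕ) {s : ℝ} (hs : 0 < s) :
    iteratedDeriv n f s = ((iteratedDeriv n (fun s : ℝ => (f s).re) s : ℝ) : ℂ) := by
  induction n generalizing s with
  | zero => simp [hf.ofReal_re hs]
  | succ n ih =>
    have hd : HasDerivAt (iteratedDeriv n f) (iteratedDeriv (n + 1) f s) (s : ℂ) := by
      rw [iteratedDeriv_succ]
      exact ((hf.differentiableOn_iteratedDeriv n).differentiableAt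
        (isOpen_rightHalfPlane.mem_nhds (by simpa using hs))).hasDerivAt
    have hev : ∀ᶠ x : ℝ in 𝓝 s, iteratedDeriv n f x =
        ((iteratedDeriv n (fun s : ℝ => (f s).re) x : ℝ) : ℂ) := by
      filter_upwards [lt_mem_nhds hs] with x hx using ih hx
    have hre : HasDerivAt (iteratedDeriv n (fun s : ℝ => (f s).re))
        (iteratedDeriv (n + 1) f s).re s :=
      hd.real_of_complex.congr_of_eventuallyEq (hev.mono fun x hx => by simp [hx])
    rw [iteratedDeriv_succ (f := fun s : ℝ => (f s).re), hre.deriv]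
    exact (hd.comp_ofReal.congr_of_eventuallyEq (hev.mono fun x hx => hx.symm)).unique
      hre.ofReal_comp |>.symm ▸ rfl

theorem hasSum_taylor (hf : IsBernstein f) (m : ℕ) {x ρ : ℝ} (hρ : ρ < x) {z : ℂ}
    (hz : ‖z - x‖ ≤ ρ) :
    HasSum (fun n : ℕ => ((n.factorial : ℂ)⁻¹ * (z - x) ^ n) *
      ((iteratedDeriv (n + m) (fun s : ℝ => (f s).re) x : ℝ) : ℂ)) (iteratedDeriv m f z) := by
  have hx : 0 < x := (norm_nonneg _).trans_lt (hz.trans_lt hρ)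
  -- The largest disc about x in the right half-plane has radius x, which allows every ρ < x.
  have hsub : Metric.ball (x : ℂ) x ⊆ {z : ℂ | 0 < z.re} := fun w hw => by
    have h1 := (Complex.abs_re_le_norm (w - x)).trans_lt (mem_ball_iff_norm.1 hw)
    have h2 := (abs_lt.1 h1).1
    simp at h2 ⊢
    linarith
  have h := Complex.hasSum_taylorSeries_on_ball
    ((hf.differentiableOn_iteratedDeriv m).mono hsub) (mem_ball_iff_norm.2 (hz.trans_lt hρ))
  have e : ∀ n : ℕ, (n.factorial : ℂ)⁻¹ • (z - x) ^ n • iteratedDeriv n (iteratedDeriv m f) x =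
      ((n.factorial : ℂ)⁻¹ * (z - x) ^ n) *
        ((iteratedDeriv (n + m) (fun s : ℝ => (f s).re) x : ℝ) : ℂ) := fun n => by
    rw [← hf.iteratedDeriv_ofReal (n + m) hx, smul_eq_mul, smul_eq_mul, mul_assoc,
      iteratedDeriv_eq_iterate, iteratedDeriv_eq_iterate, iteratedDeriv_eq_iterate,
      Function.iterate_add_apply]
  simpa only [e] using h

theorem hasSum_taylor_real (hf : IsBernstein f) (m : ℕ) {x ρ : ℝ} (hρ0 : 0 ≤ ρ) (hρ : ρ < x) :
    HasSum (fun n : ℕ => ((n.factorial : ℝ)⁻¹ * (-ρ) ^ n) *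
      iteratedDeriv (n + m) (fun s : ℝ => (f s).re) x)
      (iteratedDeriv m (fun s : ℝ => (f s).re) (x - ρ)) := by
  have h := hf.hasSum_taylor m hρ (z := (x - ρ : ℝ)) (by simp [abs_of_nonneg hρ0])
  rw [hf.iteratedDeriv_ofReal m (by linarith)] at h
  rw [← Complex.hasSum_ofReal]
  convert h using 2 with n
  push_cast
  ring

theorem abs_iteratedDeriv (hf : IsBernstein f) {n : ℕ} (hn : 1 ≤ n) {x : ℝ} (hx : 0 < x) :
    |iteratedDeriv n (fun s : ℝ => (f s).re) x| =
      -((-1) ^ n * iteratedDeriv n (fun s : ℝ => (f s).re) x) := by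
  rw [← abs_of_nonpos (hf.sign_deriv n hn x hx), abs_mul]
  simp

/-- By the alternating signs, all Taylor terms of f about x of order n ≥ 1, evaluated at x - ρ, are
nonpositive. Up to sign that series is therefore the series of absolute values, and it dominates the
Taylor series at any z with |z - x| ≤ ρ. -/
theorem norm_sub_le (hf : IsBernstein f) {x ρ : ℝ} (hρ : ρ < x) {z : ℂ} (hz : ‖z - x‖ ≤ ρ) :
    ‖f z - f x‖ ≤ (f x).re - (f ((x - ρ : ℝ) : ℂ)).re := by
  have hρ0 : 0 ≤ ρ := (norm_nonneg _).trans hz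
  have hx : 0 < x := hρ0.trans_lt hρ
  have h1 := (hasSum_nat_add_iff' 1).2 (hf.hasSum_taylor 0 hρ hz)
  have h2 := ((hasSum_nat_add_iff' 1).2 (hf.hasSum_taylor_real 0 hρ0 hρ)).neg
  simp only [Finset.range_one, Finset.sum_singleton, Nat.factorial_zero, Nat.cast_one, inv_one,
    pow_zero, mul_one, one_mul, iteratedDeriv_zero, add_zero, hf.ofReal_re hx] at h1 h2
  refine (h1.norm_le_of_bounded h2 fun n => ?_).trans_eq (by ring)
  rw [norm_mul, norm_mul, norm_inv, norm_pow, Complex.norm_real, Complex.norm_natCast,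
    Real.norm_eq_abs, hf.abs_iteratedDeriv (by omega) hx]
  calc _ ≤ ((n + 1).factorial : ℝ)⁻¹ * ρ ^ (n + 1) *
        -((-1) ^ (n + 1) * iteratedDeriv (n + 1) (fun s : ℝ => (f s).re) x) := by
        gcongr
        exact neg_nonneg.2 (hf.sign_deriv _ (by omega) x hx)
    _ = _ := by rw [neg_pow ρ]; ring

theorem norm_deriv_le (hf : IsBernstein f) {x ρ : ℝ} (hρ : ρ < x) {z : ℂ} (hz : ‖z - x‖ ≤ ρ) :
    ‖deriv f z‖ ≤ deriv (fun s : ℝ => (f s).re) (x - ρ) := by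
  have hρ0 : 0 ≤ ρ := (norm_nonneg _).trans hz
  have hx : 0 < x := hρ0.trans_lt hρ
  have h1 := hf.hasSum_taylor 1 hρ hz
  have h2 := hf.hasSum_taylor_real 1 hρ0 hρ
  rw [iteratedDeriv_one] at h1 h2
  refine h1.norm_le_of_bounded h2 fun n => ?_
  rw [norm_mul, norm_mul, norm_inv, norm_pow, Complex.norm_real, Complex.norm_natCast,
    Real.norm_eq_abs, hf.abs_iteratedDeriv (by omega) hx]
  calc _ ≤ (n.factorial : ℝ)⁻¹ * ρ ^ n *
        -((-1) ^ (n + 1) * iteratedDeriv (n + 1) (fun s : ℝ => (f s).re) x) := by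
        gcongr
        exact neg_nonneg.2 (hf.sign_deriv _ (by omega) x hx)
    _ = _ := by rw [neg_pow ρ]; ring

/-- The disc about x + y²/x of radius x/2 + y²/x contains x + iy and has leftmost real point x/2;
the bound is `norm_deriv_le` for this disc. -/
theorem norm_deriv_le_deriv_half_re (hf : IsBernstein f) {x : ℝ} (hx : 0 < x) (y : ℝ) :
    ‖deriv f (x + y * Complex.I)‖ ≤ deriv (fun s : ℝ => (f s).re) (x / 2) := by
  have hy : 0 ≤ y ^ 2 / x := by positivity
  have h := hf.norm_deriv_le (x := x + y ^ 2 / x) (ρ := x / 2 + y ^ 2 / x) (by linarith)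
    (z := x + y * Complex.I) ?_
  · convert h using 2
    ring
  · have : (x + y * Complex.I - ((x + y ^ 2 / x : ℝ) : ℂ)) =
        ((-(y ^ 2 / x) : ℝ) : ℂ) + y * Complex.I := by push_cast; ring
    rw [this, Complex.norm_add_mul_I]
    refine Real.sqrt_le_iff.2 ⟨by positivity, ?_⟩
    have e : x * (y ^ 2 / x) = y ^ 2 := by field_simp
    nlinarith [sq_nonneg x]

theorem re_mono (hf : IsBernstein f) {x y : ℝ} (hx : 0 < x) (hxy : x ≤ y) :
    (f x).re ≤ (f y).re := by
  have h := hf.norm_sub_le (x := y) (ρ := y - x) (by linarith) (z := x)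
    (by rw [← Complex.ofReal_sub, Complex.norm_real, Real.norm_eq_abs, abs_sub_comm,
      abs_of_nonneg (by linarith)])
  have := (norm_nonneg _).trans h
  simp only [sub_sub_cancel] at this
  linarith

/-- A Bernstein function in the right half-plane is dominated by its values on the half-line. -/
theorem norm_le (hf : IsBernstein f) {x : ℝ} (hx : 0 < x) (y : ℝ) :
    ‖f (x + y * Complex.I)‖ ≤ 4 * (f ((x + |y| : ℝ) : ℂ)).re := by
  have hy := abs_nonneg y
  set X : ℝ := x + |y| with hX
  have hX0 : 0 < X := by positivity
  have hd : ∀ s : ℝ, 0 < s → HasDerivAt (fun s : ℝ => f (s + y * Complex.I))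
      (deriv f (s + y * Complex.I)) s := fun s hs => by
    have h1 : HasDerivAt f (deriv f (s + y * Complex.I)) (s + y * Complex.I) :=
      (hf.holomorphic.differentiableAt
        (isOpen_rightHalfPlane.mem_nhds (by simpa using hs))).hasDerivAt
    exact (h1.comp_add_const (s : ℂ) (y * Complex.I)).comp_ofReal
  have hu : ∀ s : ℝ, 0 < s → HasDerivAt (fun s : ℝ => (f s).re)
      (deriv (fun s : ℝ => (f s).re) s) s := fun s hs =>
    ((hf.holomorphic.differentiableAt
        (isOpen_rightHalfPlane.mem_nhds (by simpa using hs))).hasDerivAt.real_of_complex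
        ).differentiableAt.hasDerivAt
  have hB : ∀ s : ℝ, 0 < s → HasDerivAt
      (fun s : ℝ => 2 * ((f ((s / 2 : ℝ) : ℂ)).re - (f ((x / 2 : ℝ) : ℂ)).re))
      (deriv (fun s : ℝ => (f s).re) (s / 2)) s := fun s hs => by
    have := (((hu (s / 2) (by positivity)).scomp s
      ((hasDerivAt_id s).div_const 2)).sub_const ((f ((x / 2 : ℝ) : ℂ)).re)).const_mul 2
    exact this.congr_deriv (by rw [smul_eq_mul]; ring)
  -- Horizontal move from x + iy to X + iy: with u = Re f on the half-line, |f'(s+iy)| ≤ u'(s/2),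
  -- which is the derivative of 2u(s/2).
  have h1 : ‖f (X + y * Complex.I) - f (x + y * Complex.I)‖ ≤
      2 * ((f ((X / 2 : ℝ) : ℂ)).re - (f ((x / 2 : ℝ) : ℂ)).re) := by
    refine image_norm_le_of_norm_deriv_right_le_deriv_boundary'
      (f := fun s : ℝ => f (s + y * Complex.I) - f (x + y * Complex.I)) (a := x) (b := X)
      (f' := fun s => deriv f (s + y * Complex.I))
      (B' := fun s => deriv (fun s : ℝ => (f s).re) (s / 2))
      (fun s hs => ((hd s (hx.trans_le hs.1)).sub_const _).continuousAt.continuousWithinAt)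
      (fun s hs => ((hd s (hx.trans_le hs.1)).sub_const _).hasDerivWithinAt)
      (by simp)
      (fun s hs => (hB s (hx.trans_le hs.1)).continuousAt.continuousWithinAt)
      (fun s hs => (hB s (hx.trans_le hs.1)).hasDerivWithinAt)
      (fun s hs => hf.norm_deriv_le_deriv_half_re (hx.trans_le hs.1) y)
      (Set.right_mem_Icc.2 (by linarith))
  -- Vertical move from X + iy to X: the disc about X of radius |y| still reaches only down to x >
  -- 0. The constant 4 is then 1 + 1 + 2.
  have h2 : ‖f (X + y * Complex.I) - f X‖ ≤ (f X).re - (f ((X - |y| : ℝ) : ℂ)).re :=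
    hf.norm_sub_le (by linarith) (by simp)
  have h3 : ‖f X‖ = (f X).re := by
    rw [← hf.ofReal_re hX0, Complex.norm_real, Real.norm_eq_abs,
      abs_of_nonneg (hf.nonneg X hX0), Complex.ofReal_re]
  have h4 := hf.nonneg (X - |y|) (by linarith)
  have h5 := hf.nonneg (x / 2) (by linarith)
  have h6 := hf.re_mono (x := X / 2) (y := X) (by linarith) (by linarith)
  calc ‖f (x + y * Complex.I)‖ = ‖f X + (f (X + y * Complex.I) - f X) -
        (f (X + y * Complex.I) - f (x + y * Complex.I))‖ := by congr 1; ring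
    _ ≤ ‖f X‖ + ‖f (X + y * Complex.I) - f X‖ +
        ‖f (X + y * Complex.I) - f (x + y * Complex.I)‖ :=
      (_root_.norm_sub_le _ _).trans (by gcongr; exact norm_add_le _ _)
    _ ≤ 4 * (f X).re := by linarith

end IsBernstein

/-! ### Lévy triples -/

/-- `μ` is a measure on `(0, ∞)` with `∫ s / (1 + s) μ(ds) < ∞`. -/
structure IsLevyMeasure (μ : Measure ℝ) : Prop where
  null : μ (Set.Iic 0) = 0
  finite : ∫⁻ s, ENNReal.ofReal (s / (1 + s)) ∂μ < ∞

theorem HasLevyTriple.isLevyMeasure {g : ℂ → ℂ} {a b : ℝ} {μ : Measure ℝ}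
    (h : HasLevyTriple g a b μ) : IsLevyMeasure μ := ⟨h.null, h.finite⟩

theorem Complex.norm_one_sub_exp_neg_le {w : ℂ} (hw : 0 ≤ w.re) :
    ‖1 - Complex.exp (-w)‖ ≤ 2 ∧ ‖1 - Complex.exp (-w)‖ ≤ 2 * ‖w‖ := by
  have h2 : ‖1 - Complex.exp (-w)‖ ≤ 2 := by
    refine (norm_sub_le _ _).trans ?_
    rw [norm_one, Complex.norm_exp]
    have : Real.exp (-w).re ≤ 1 := by simpa using hw
    linarith
  refine ⟨h2, ?_⟩
  rcases le_total ‖w‖ 1 with h | h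
  · rw [norm_sub_rev, ← norm_neg w]
    exact Complex.norm_exp_sub_one_le (by rwa [norm_neg])
  · linarith

namespace IsLevyMeasure

variable {μ : Measure ℝ}

theorem ae_pos (h : IsLevyMeasure μ) : ∀ᵐ s ∂μ, 0 < s := by
  rw [ae_iff]
  convert h.null using 2
  ext s
  simp

theorem integrable_weight (h : IsLevyMeasure μ) : Integrable (fun s => s / (1 + s)) μ := by
  refine ⟨(measurable_id.div (measurable_const.add measurable_id)).aestronglyMeasurable, ?_⟩
  refine lt_of_eq_of_lt (lintegral_congr_ae ?_) h.finite
  filter_upwards [h.ae_pos] with s hs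
  exact Real.enorm_of_nonneg (by positivity)

/-- The integrable function s/(1+s) is positive almost everywhere, so it charges a σ-finite set of
full measure. Fubini for the kernel depends on this. -/
theorem sigmaFinite (h : IsLevyMeasure μ) : SigmaFinite μ := by
  have hw := h.integrable_weight.aefinStronglyMeasurable
  have hmem : ∀ᵐ s ∂μ, s ∈ hw.sigmaFiniteSet := by
    have h0 := (ae_restrict_iff' hw.measurableSet.compl).1 hw.ae_eq_zero_compl
    filter_upwards [h0, h.ae_pos] with s hs hs0
    by_contra hc
    have : s / (1 + s) = 0 := hs hc
    have : 0 < s / (1 + s) := by positivity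
    linarith
  have := hw.sigmaFinite_restrict
  rwa [Measure.restrict_eq_self_of_ae_mem hmem] at this

/-- Adding the two bounds, one of them multiplied by s, gives ‖F(s)‖(1+s) ≤ 2Cs. -/
theorem integrable_of_norm_le (h : IsLevyMeasure μ) {E : Type*} [NormedAddCommGroup E]
    {F : ℝ → E} (hF : AEStronglyMeasurable F μ) {C : ℝ}
    (hC : ∀ s, 0 < s → ‖F s‖ ≤ C ∧ ‖F s‖ ≤ C * s) : Integrable F μ := by
  refine (h.integrable_weight.const_mul (2 * C)).mono' hF ?_
  filter_upwards [h.ae_pos] with s hs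
  rw [← mul_div_assoc, le_div_iff₀ (by linarith)]
  have := hC s hs
  nlinarith [norm_nonneg (F s)]

theorem integrable_one_sub_cexp (h : IsLevyMeasure μ) {z : ℂ} (hz : 0 ≤ z.re) :
    Integrable (fun s : ℝ => 1 - Complex.exp (-(s * z))) μ := by
  refine h.integrable_of_norm_le (by fun_prop) (C := 2 + 2 * ‖z‖) fun s hs => ?_
  have := Complex.norm_one_sub_exp_neg_le (w := s * z) (by simp; positivity)
  rw [norm_mul, Complex.norm_real, Real.norm_of_nonneg hs.le] at this
  constructor <;> nlinarith [norm_nonneg z]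

theorem integrable_one_sub_exp (h : IsLevyMeasure μ) {t : ℝ} (ht : 0 ≤ t) :
    Integrable (fun s : ℝ => 1 - Real.exp (-(s * t))) μ := by
  refine (h.integrable_one_sub_cexp (z := t) (by simpa)).re.congr (.of_forall fun s => ?_)
  have : Complex.exp (-(s * t)) = ((Real.exp (-(s * t)) : ℝ) : ℂ) := by push_cast; rfl
  show (1 - Complex.exp (-(s * t))).re = 1 - Real.exp (-(s * t))
  rw [this, Complex.sub_re, Complex.one_re, Complex.ofReal_re]

theorem integrable_min (h : IsLevyMeasure μ) {t : ℝ} (ht : 0 < t) :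
    Integrable (fun s : ℝ => min (s / t) 1) μ := by
  refine h.integrable_of_norm_le (by fun_prop) (C := 1 + 1 / t) fun s hs => ?_
  have hp : 0 ≤ s / t := by positivity
  have hp' : 0 ≤ 1 / t := by positivity
  rw [Real.norm_of_nonneg (by positivity)]
  constructor
  · linarith [min_le_right (s / t) 1]
  · have : s / t = 1 / t * s := by ring
    linarith [min_le_left (s / t) 1]

end IsLevyMeasure

/-- The function `a + b z + ∫ (1 - e^{-sz}) μ(ds)` on the closed right half-plane. -/
noncomputable def levyFunction (a b : ℝ) (μ : Measure ℝ) (z : ℂ) : ℂ :=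
  a + b * z + ∫ s : ℝ, (1 - Complex.exp (-(s * z))) ∂μ

/-- The density of `(δ₀ - δₛ) * e^{-r} dr` on `(0, ∞)`. -/
noncomputable def levyAux (s r : ℝ) : ℂ :=
  Complex.exp (-r) - (Set.Ioi s).indicator (fun r : ℝ => Complex.exp (s - r)) r

/-- The density of the absolutely continuous part of the measure with Laplace transform
`(a + b z + ∫ (1 - e^{-sz}) μ(ds)) / (1 + z)`. -/
noncomputable def levyKernel (a b : ℝ) (μ : Measure ℝ) (r : ℝ) : ℂ :=
  (a - b) * Complex.exp (-r) + ∫ s, levyAux s r ∂μ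

theorem measurable_levyAux : Measurable (Function.uncurry levyAux) := by
  have : Function.uncurry levyAux = fun p : ℝ × ℝ => Complex.exp (-p.2) -
      {q : ℝ × ℝ | q.1 < q.2}.indicator (fun q => Complex.exp (q.1 - q.2)) p := by
    ext p
    simp [Function.uncurry, levyAux, Set.indicator]
  rw [this]
  refine Measurable.sub (by fun_prop) (Measurable.indicator (by fun_prop) ?_)
  exact measurableSet_lt measurable_fst measurable_snd

theorem exp_mul_levyAux (z : ℂ) (s r : ℝ) : Complex.exp (-(r * z)) * levyAux s r =
    Complex.exp (-(1 + z) * r) - (Set.Ioi s).indicator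
      (fun r : ℝ => Complex.exp s * Complex.exp (-(1 + z) * r)) r := by
  rw [levyAux, mul_sub, ← Complex.exp_add]
  congr 1
  · ring_nf
  · by_cases h : r ∈ Set.Ioi s
    · rw [Set.indicator_of_mem h, Set.indicator_of_mem h, ← Complex.exp_add, ← Complex.exp_add]
      ring_nf
    · simp [Set.indicator_of_notMem h]

/-- The constant c is free because two cases are needed: c = -e^s gives the Laplace transform of
`levyAux`, and c = e^s - 2 its L¹ norm. -/
theorem integral_exp_add_indicator {w : ℂ} (hw : w.re < 0) (c : ℂ) {s : ℝ} (hs : 0 < s) :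
    IntegrableOn (fun r : ℝ => Complex.exp (w * r) + (Set.Ioi s).indicator
      (fun r : ℝ => c * Complex.exp (w * r)) r) (Set.Ioi 0) ∧
    ∫ r in Set.Ioi (0 : ℝ), (Complex.exp (w * r) + (Set.Ioi s).indicator
      (fun r : ℝ => c * Complex.exp (w * r)) r) = (-1 - c * Complex.exp (w * s)) / w := by
  have h1 := integrableOn_exp_mul_complex_Ioi hw 0
  have h2 : IntegrableOn ((Set.Ioi s).indicator (fun r : ℝ => c * Complex.exp (w * r)))
      (Set.Ioi 0) :=
    ((integrable_indicator_iff measurableSet_Ioi).2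
      ((integrableOn_exp_mul_complex_Ioi hw s).const_mul c)).integrableOn
  refine ⟨h1.add h2, ?_⟩
  rw [integral_add h1 h2, integral_exp_mul_complex_Ioi hw, setIntegral_indicator measurableSet_Ioi,
    Set.inter_eq_right.2 (Set.Ioi_subset_Ioi hs.le), integral_const_mul,
    integral_exp_mul_complex_Ioi hw]
  simp
  ring

theorem integral_exp_mul_levyAux {z : ℂ} (hz : 0 ≤ z.re) {s : ℝ} (hs : 0 < s) :
    IntegrableOn (fun r : ℝ => Complex.exp (-(r * z)) * levyAux s r) (Set.Ioi 0) ∧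
    ∫ r in Set.Ioi (0 : ℝ), Complex.exp (-(r * z)) * levyAux s r =
      (1 - Complex.exp (-(s * z))) / (1 + z) := by
  have hw : (-(1 + z)).re < 0 := by simp; linarith
  have h := integral_exp_add_indicator hw (-Complex.exp s) hs
  have e : (fun r : ℝ => Complex.exp (-(r * z)) * levyAux s r) = fun r : ℝ =>
      Complex.exp (-(1 + z) * r) + (Set.Ioi s).indicator
      (fun r : ℝ => -Complex.exp s * Complex.exp (-(1 + z) * r)) r := by
    ext r
    rw [exp_mul_levyAux, sub_eq_add_neg]
    by_cases h : r ∈ Set.Ioi s <;> simp [h]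
  rw [e]
  refine ⟨h.1, h.2.trans ?_⟩
  rw [neg_mul, ← Complex.exp_add, div_neg, ← neg_div]
  congr 1
  rw [show (s : ℂ) + -(1 + z) * s = -(s * z) by ring]
  ring

/-- The density changes sign at s: beyond s its modulus is e^{s-r} - e^{-r} = e^{-r} + (e^s -
2)e^{-r}. The resulting norm is integrable against a Lévy measure, which makes `levyKernel`
integrable. -/
theorem integral_norm_levyAux {s : ℝ} (hs : 0 < s) :
    ∫ r in Set.Ioi (0 : ℝ), ‖levyAux s r‖ = 2 * (1 - Real.exp (-s)) := by
  have h := integral_exp_add_indicator (w := -1) (by simp) (Complex.exp s - 2) hs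
  have e : ∀ r : ℝ, ((‖levyAux s r‖ : ℝ) : ℂ) = Complex.exp (-1 * r) +
      (Set.Ioi s).indicator (fun r : ℝ => (Complex.exp s - 2) * Complex.exp (-1 * r)) r := by
    intro r
    have e1 : ∀ u : ℝ, Complex.exp u = ((Real.exp u : ℝ) : ℂ) := fun u => by push_cast; rfl
    by_cases hr : r ∈ Set.Ioi s
    · have hr' : s < r := hr
      have : Real.exp (-r) ≤ Real.exp (s - r) := Real.exp_le_exp.2 (by linarith)
      have e2 : levyAux s r = ((Real.exp (-r) - Real.exp (s - r) : ℝ) : ℂ) := by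
        rw [levyAux, Set.indicator_of_mem hr]
        push_cast
        rfl
      rw [e2, Complex.norm_real, Real.norm_eq_abs, abs_of_nonpos (by linarith),
        Set.indicator_of_mem hr, sub_mul, ← Complex.exp_add]
      push_cast
      ring_nf
    · rw [levyAux, Set.indicator_of_notMem hr, Set.indicator_of_notMem hr, sub_zero, add_zero,
        neg_one_mul, ← Complex.ofReal_neg, e1, Complex.norm_real,
        Real.norm_of_nonneg (Real.exp_pos _).le]
  rw [← Complex.ofReal_inj, ← integral_complex_ofReal]
  simp only [e]
  rw [h.2, sub_mul, ← Complex.exp_add]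
  push_cast
  rw [show (s : ℂ) + -1 * s = 0 by ring, Complex.exp_zero]
  ring_nf

section Kernel

variable {μ : Measure ℝ} (a b : ℝ)

theorem integrable_levyAux_prod (h : IsLevyMeasure μ) :
    Integrable (Function.uncurry levyAux) (μ.prod (volume.restrict (Set.Ioi 0))) := by
  have := h.sigmaFinite
  rw [integrable_prod_iff measurable_levyAux.aestronglyMeasurable]
  constructor
  · filter_upwards [h.ae_pos] with s hs
    have := (integral_exp_mul_levyAux (z := 0) (by simp) hs).1
    simpa [IntegrableOn] using this
  · refine ((h.integrable_one_sub_exp zero_le_one).const_mul 2).congr ?_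
    filter_upwards [h.ae_pos] with s hs
    simpa using (integral_norm_levyAux hs).symm

theorem norm_exp_neg_ofReal_mul_le {r : ℝ} (hr : 0 ≤ r) {z : ℂ} (hz : 0 ≤ z.re) :
    ‖Complex.exp (-(r * z))‖ ≤ 1 := by
  rw [Complex.norm_exp]
  simpa using mul_nonneg hr hz

theorem integrableOn_levyKernel (h : IsLevyMeasure μ) :
    IntegrableOn (levyKernel a b μ) (Set.Ioi 0) := by
  have := h.sigmaFinite
  refine Integrable.add ?_ (integrable_levyAux_prod h).integral_prod_right
  have := integrableOn_exp_mul_complex_Ioi (a := -1) (by simp) 0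
  simpa using this.const_mul _

/-- Since e^{-r} dr has transform 1/(1+z), one has (a + bz)/(1+z) = b + (a - b)/(1+z), and (1 -
e^{-sz})/(1+z) is the transform of (δ₀ - δₛ) * e^{-r} dr. Integration in s is Fubini. Boundary
points Re z = 0 are included because σ(A) may meet the imaginary axis. -/
theorem integral_exp_mul_levyKernel (h : IsLevyMeasure μ) {z : ℂ} (hz : 0 ≤ z.re) :
    b + ∫ r in Set.Ioi (0 : ℝ), Complex.exp (-(r * z)) * levyKernel a b μ r =
      levyFunction a b μ z / (1 + z) := by
  have := h.sigmaFinite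
  have hz1 : 1 + z ≠ 0 := fun h0 => by
    have := congrArg Complex.re h0
    simp at this
    linarith
  have hw : (-(1 + z)).re < 0 := by simp; linarith
  have hF : Integrable (Function.uncurry fun s r : ℝ => Complex.exp (-(r * z)) * levyAux s r)
      (μ.prod (volume.restrict (Set.Ioi 0))) := by
    refine (integrable_levyAux_prod h).bdd_mul (c := 1)
      (f := fun p : ℝ × ℝ => Complex.exp (-(p.2 * z))) (by fun_prop) ?_
    have : ∀ᵐ p ∂(μ.prod (volume.restrict (Set.Ioi (0 : ℝ)))), p.2 ∈ Set.Ioi (0 : ℝ) :=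
      Measure.quasiMeasurePreserving_snd.ae (ae_restrict_mem measurableSet_Ioi)
    filter_upwards [this] with p hp
    exact norm_exp_neg_ofReal_mul_le (le_of_lt hp) hz
  have h1 : ∫ r in Set.Ioi (0 : ℝ), ∫ s, Complex.exp (-(r * z)) * levyAux s r ∂μ =
      (∫ s : ℝ, (1 - Complex.exp (-(s * z))) ∂μ) / (1 + z) := by
    rw [← integral_integral_swap hF, ← integral_div]
    refine integral_congr_ae ?_
    filter_upwards [h.ae_pos] with s hs using (integral_exp_mul_levyAux hz hs).2
  have h2 : Integrable (fun r : ℝ => ((a : ℂ) - b) * Complex.exp (-(1 + z) * r))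
      (volume.restrict (Set.Ioi 0)) := (integrableOn_exp_mul_complex_Ioi hw 0).const_mul _
  have e : ∀ r : ℝ, Complex.exp (-(r * z)) * levyKernel a b μ r =
      ((a : ℂ) - b) * Complex.exp (-(1 + z) * r) +
        ∫ s, Complex.exp (-(r * z)) * levyAux s r ∂μ := fun r => by
    rw [levyKernel, mul_add, integral_const_mul, mul_left_comm, ← Complex.exp_add]
    ring_nf
  simp only [e]
  have h3 : Integrable (fun r : ℝ => ∫ s, Complex.exp (-(r * z)) * levyAux s r ∂μ)
      (volume.restrict (Set.Ioi 0)) := hF.integral_prod_right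
  rw [integral_add h2 h3, h1, integral_const_mul,
    integral_exp_mul_complex_Ioi hw, levyFunction]
  simp only [Complex.ofReal_zero, mul_zero, Complex.exp_zero]
  field_simp
  ring

end Kernel

theorem continuousOn_laplaceIntegral {k : ℝ → ℂ} (hk : IntegrableOn k (Set.Ioi 0)) :
    ContinuousOn (fun z : ℂ => ∫ r in Set.Ioi (0 : ℝ), Complex.exp (-(r * z)) * k r)
      {z : ℂ | 0 ≤ z.re} := by
  refine continuousOn_of_dominated (bound := fun r => ‖k r‖)
    (fun z _ => AEStronglyMeasurable.mul (by fun_prop) hk.1) (fun z hz => ?_) hk.norm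
    (.of_forall fun r => by fun_prop)
  filter_upwards [ae_restrict_mem measurableSet_Ioi] with r hr
  rw [norm_mul]
  exact mul_le_of_le_one_left (norm_nonneg _) (norm_exp_neg_ofReal_mul_le (le_of_lt hr) hz)

theorem differentiableOn_laplaceIntegral {k : ℝ → ℂ} (hk : IntegrableOn k (Set.Ioi 0)) :
    DifferentiableOn ℂ (fun z : ℂ => ∫ r in Set.Ioi (0 : ℝ), Complex.exp (-(r * z)) * k r)
      {z : ℂ | 0 < z.re} := by
  intro z hz
  have hz' : 0 < z.re := hz
  have hm : ∀ w : ℂ, AEStronglyMeasurable (fun r : ℝ => Complex.exp (-(r * w)) * k r)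
      (volume.restrict (Set.Ioi 0)) := fun w => AEStronglyMeasurable.mul (by fun_prop) hk.1
  have hnhds : {w : ℂ | z.re / 2 < w.re} ∈ 𝓝 z :=
    (isOpen_lt continuous_const Complex.continuous_re).mem_nhds (by simp; linarith)
  refine (hasDerivAt_integral_of_dominated_loc_of_deriv_le (𝕜 := ℂ)
    (F := fun (z : ℂ) (r : ℝ) => Complex.exp (-(r * z)) * k r)
    (F' := fun (z : ℂ) (r : ℝ) => -r * (Complex.exp (-(r * z)) * k r))
    (bound := fun r => 2 / z.re * ‖k r‖) hnhds (.of_forall hm) ?_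
    (AEStronglyMeasurable.mul (by fun_prop) (hm z)) ?_
    (hk.norm.const_mul _) (.of_forall fun r w _ => ?_)).2.differentiableAt.differentiableWithinAt
  · refine hk.norm.mono' (hm z) ?_
    filter_upwards [ae_restrict_mem measurableSet_Ioi] with r hr
    rw [norm_mul]
    exact mul_le_of_le_one_left (norm_nonneg _) (norm_exp_neg_ofReal_mul_le (le_of_lt hr) hz'.le)
  · filter_upwards [ae_restrict_mem measurableSet_Ioi] with r hr w hw
    have hr' : 0 < r := hr
    have hw' : z.re / 2 < w.re := hw
    rw [norm_mul, norm_mul, ← mul_assoc]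
    refine mul_le_mul_of_nonneg_right ?_ (norm_nonneg _)
    rw [norm_neg, Complex.norm_real, Real.norm_of_nonneg hr'.le, Complex.norm_exp]
    have h1 : (-(r * w)).re = -(r * w.re) := by simp
    rw [h1, Real.exp_neg, ← div_eq_mul_inv, div_le_div_iff₀ (Real.exp_pos _) hz']
    have h2 := Real.add_one_le_exp (r * w.re)
    nlinarith
  · have h1 : HasDerivAt (fun w : ℂ => Complex.exp (-(r * w))) (Complex.exp (-(r * w)) * -r) w := by
      have := ((hasDerivAt_id w).const_mul (r : ℂ)).neg.cexp
      simpa using this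
    exact (h1.mul_const (k r)).congr_deriv (by ring)

/-! ### The Lévy representation on the closed half-plane, its monotonicity and lower bounds. -/

section LevyFunction

variable {a b : ℝ} {μ : Measure ℝ}

theorem one_add_ne_zero_of_re_nonneg {z : ℂ} (hz : 0 ≤ z.re) : 1 + z ≠ 0 := fun h0 => by
  have := congrArg Complex.re h0
  simp at this
  linarith

theorem levyFunction_eq (h : IsLevyMeasure μ) {z : ℂ} (hz : 0 ≤ z.re) :
    levyFunction a b μ z = (1 + z) *
      (b + ∫ r in Set.Ioi (0 : ℝ), Complex.exp (-(r * z)) * levyKernel a b μ r) := by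
  rw [integral_exp_mul_levyKernel a b h hz, mul_div_cancel₀ _ (one_add_ne_zero_of_re_nonneg hz)]

theorem continuousOn_levyFunction (h : IsLevyMeasure μ) :
    ContinuousOn (levyFunction a b μ) {z : ℂ | 0 ≤ z.re} := by
  refine ContinuousOn.congr ?_ fun z hz => levyFunction_eq h hz
  exact ContinuousOn.mul (by fun_prop)
    (continuousOn_const.add (continuousOn_laplaceIntegral (integrableOn_levyKernel a b h)))

theorem differentiableOn_levyFunction (h : IsLevyMeasure μ) :
    DifferentiableOn ℂ (levyFunction a b μ) {z : ℂ | 0 < z.re} := by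
  refine DifferentiableOn.congr ?_ fun z hz => levyFunction_eq h (le_of_lt hz)
  exact DifferentiableOn.mul (by fun_prop)
    ((differentiableOn_const _).add
      (differentiableOn_laplaceIntegral (integrableOn_levyKernel a b h)))

theorem levyFunction_ofReal (t : ℝ) : levyFunction a b μ t =
    ((a + b * t + ∫ s, (1 - Real.exp (-(s * t))) ∂μ : ℝ) : ℂ) := by
  rw [levyFunction]
  push_cast
  rw [← integral_complex_ofReal]
  push_cast
  rfl

/-- A holomorphic function with a Lévy triple agrees with its Lévy representation in the right
half-plane. -/
theorem HasLevyTriple.eqOn {g : ℂ → ℂ} (h : HasLevyTriple g a b μ)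
    (hg : DifferentiableOn ℂ g {z : ℂ | 0 < z.re}) :
    Set.EqOn g (levyFunction a b μ) {z : ℂ | 0 < z.re} := by
  refine (hg.analyticOnNhd isOpen_rightHalfPlane).eqOn_of_preconnected_of_frequently_eq
    ((differentiableOn_levyFunction h.isLevyMeasure).analyticOnNhd isOpen_rightHalfPlane)
    (convex_halfSpace_re_gt 0).isPreconnected (z₀ := 1) (by simp) ?_
  have ht : Tendsto (fun t : ℝ => (t : ℂ)) (𝓝[≠] 1) (𝓝[≠] 1) := by
    refine tendsto_nhdsWithin_iff.2 ⟨?_, ?_⟩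
    · exact (Complex.continuous_ofReal.tendsto' 1 1 (by simp)).mono_left nhdsWithin_le_nhds
    · filter_upwards [self_mem_nhdsWithin] with t ht
      simpa using ht
  refine ht.frequently (Eventually.frequently ?_)
  filter_upwards [nhdsWithin_le_nhds (lt_mem_nhds one_pos)] with t ht
  rw [h.repr t ht, levyFunction_ofReal]

theorem re_levyFunction_ofReal (t : ℝ) : (levyFunction a b μ t).re =
    a + b * t + ∫ s, (1 - Real.exp (-(s * t))) ∂μ := by
  rw [levyFunction_ofReal, Complex.ofReal_re]

theorem re_levyFunction_mono (hb : 0 ≤ b) (h : IsLevyMeasure μ) {s t : ℝ} (hs : 0 ≤ s)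
    (hst : s ≤ t) : (levyFunction a b μ s).re ≤ (levyFunction a b μ t).re := by
  rw [re_levyFunction_ofReal, re_levyFunction_ofReal]
  refine add_le_add (by gcongr) ?_
  refine integral_mono_ae (h.integrable_one_sub_exp hs)
    (h.integrable_one_sub_exp (hs.trans hst)) ?_
  filter_upwards [h.ae_pos] with u hu
  gcongr

/-- Pointwise, Re e^{-sz} ≤ |e^{-sz}| = e^{-s Re z}. This shows that g has no zeros in the open
half-plane. -/
theorem re_levyFunction_re_le (h : IsLevyMeasure μ) {z : ℂ} (hz : 0 ≤ z.re) :
    (levyFunction a b μ z.re).re ≤ (levyFunction a b μ z).re := by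
  rw [re_levyFunction_ofReal, levyFunction]
  have e : (∫ s : ℝ, (1 - Complex.exp (-(s * z))) ∂μ).re =
      ∫ s : ℝ, (1 - Complex.exp (-(s * z))).re ∂μ :=
    (integral_re (h.integrable_one_sub_cexp hz)).symm
  simp only [Complex.add_re, Complex.ofReal_re, Complex.re_ofReal_mul, e]
  gcongr
  · exact h.integrable_one_sub_exp hz
  · exact (h.integrable_one_sub_cexp hz).re
  · intro s
    have : (Complex.exp (-(s * z))).re ≤ Real.exp (-(s * z.re)) := by
      refine (Complex.re_le_norm _).trans_eq ?_
      rw [Complex.norm_exp]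
      simp
    simp only [Complex.sub_re, Complex.one_re]
    linarith

/-- With u = sx, the integrands satisfy min(4u, 1) ≤ 8u/(1+u) ≤ 8(1 - e^{-u}). The factor 4 in the
time matches the one at which the Cesàro symbol is at least 1/2. -/
theorem levyRate_le (ha : 0 ≤ a) (hb : 0 ≤ b) (h : IsLevyMeasure μ) {x : ℝ} (hx : 0 < x) :
    levyRate a b μ (1 / (4 * x)) ≤ 8 * (levyFunction a b μ x).re := by
  rw [re_levyFunction_ofReal, levyRate]
  have h1 : ∫ s, min (s / (1 / (4 * x))) 1 ∂μ ≤ ∫ s, 8 * (1 - Real.exp (-(s * x))) ∂μ := by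
    refine integral_mono_ae (h.integrable_min (by positivity))
      ((h.integrable_one_sub_exp hx.le).const_mul 8) ?_
    filter_upwards [h.ae_pos] with s hs
    have hu : 0 < s * x := by positivity
    have e : s / (1 / (4 * x)) = 4 * (s * x) := by field_simp
    have h2 : Real.exp (-(s * x)) ≤ 1 / (1 + s * x) := by
      rw [Real.exp_neg, ← one_div]
      exact one_div_le_one_div_of_le (by linarith) (by linarith [Real.add_one_le_exp (s * x)])
    have h3 : 1 - 1 / (1 + s * x) = s * x / (1 + s * x) := by field_simp; ring
    have h4 : min (4 * (s * x)) 1 ≤ 8 * (s * x / (1 + s * x)) := by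
      rw [← mul_div_assoc, le_div_iff₀ (by linarith)]
      rcases le_total (s * x) 1 with h5 | h5
      · nlinarith [min_le_left (4 * (s * x)) 1]
      · nlinarith [min_le_right (4 * (s * x)) 1]
    simp only [e]
    linarith
  rw [integral_const_mul] at h1
  have h2 : b / (1 / (4 * x)) = 4 * (b * x) := by field_simp
  have h3 : 0 ≤ b * x := by positivity
  rw [h2]
  linarith

/-- A special Bernstein function is bounded below in the closed right half-plane by its values on
the half-line. -/
theorem norm_levyFunction_ge {g : ℂ → ℂ} (hg : IsSpecialBernstein g) (h : HasLevyTriple g a b μ)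
    (hpos : ∀ t : ℝ, 0 < t → 0 < (levyFunction a b μ t).re) {z : ℂ} (hz : 0 ≤ z.re) :
    (levyFunction a b μ ‖z‖).re ≤ 8 * ‖levyFunction a b μ z‖ := by
  have hL := h.isLevyMeasure
  have heq := h.eqOn hg.bernstein.holomorphic
  -- The growth bound for z/g reads |w|/|g(w)| ≤ 4X/g(X) with X = Re w + |Im w|. As |w| ≤ X ≤ 2|w|,
  -- this gives g(|w|) ≤ g(X) ≤ 8|g(w)|.
  have key : ∀ w : ℂ, 0 < w.re → (levyFunction a b μ ‖w‖).re ≤ 8 * ‖levyFunction a b μ w‖ := by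
    intro w hw
    have hX : 0 < w.re + |w.im| := by positivity
    have h1 := hg.bernstein_div.norm_le hw w.im
    simp only [Complex.re_add_im] at h1
    have hgw : g w ≠ 0 := fun h0 => by
      have h2 := (hpos w.re hw).trans_le (re_levyFunction_re_le hL hw.le)
      rw [← heq hw, h0] at h2
      simp at h2
    rw [heq (x := ((w.re + |w.im| : ℝ) : ℂ)) (by simpa using hX), levyFunction_ofReal,
      ← Complex.ofReal_div, Complex.ofReal_re, ← re_levyFunction_ofReal, norm_div,
      div_le_iff₀ (norm_pos_iff.2 hgw)] at h1
    have hpX := hpos _ hX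
    have h3 : w.re + |w.im| ≤ 2 * ‖w‖ := by
      linarith [Complex.re_le_norm w, Complex.abs_im_le_norm w]
    have h4 : ‖w‖ ≤ w.re + |w.im| := by
      have := Complex.norm_le_abs_re_add_abs_im w
      rwa [abs_of_pos hw] at this
    have hw0 : 0 < ‖w‖ := by linarith
    rw [← heq hw]
    refine (re_levyFunction_mono h.nonneg_b hL (norm_nonneg w) h4).trans ?_
    rw [mul_div_assoc', div_mul_eq_mul_div, le_div_iff₀ hpX] at h1
    have h5 : 4 * (w.re + |w.im|) * ‖g w‖ ≤ ‖w‖ * (8 * ‖g w‖) := by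
      nlinarith [norm_nonneg (g w)]
    exact le_of_mul_le_mul_left (h1.trans h5) hw0
  -- Boundary points are reached by shifting z to the right: |z + δ| ≥ |z|, so the left side only
  -- grows, while the right side converges by continuity.
  have ht : Tendsto (fun δ : ℝ => z + δ) (𝓝[>] 0) (𝓝[{z : ℂ | 0 ≤ z.re}] z) := by
    refine tendsto_nhdsWithin_iff.2 ⟨?_, ?_⟩
    · have : Continuous (fun δ : ℝ => z + δ) := by fun_prop
      exact (this.tendsto' 0 z (by simp)).mono_left nhdsWithin_le_nhds
    · filter_upwards [self_mem_nhdsWithin] with δ hδ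
      have : 0 < δ := hδ
      simp
      linarith
  have hlim :=
    (((continuousOn_levyFunction (a := a) (b := b) hL z hz).tendsto.comp ht).norm).const_mul 8
  refine ge_of_tendsto hlim ?_
  filter_upwards [self_mem_nhdsWithin] with δ hδ
  have hδ' : 0 < δ := hδ
  have hre : 0 < (z + δ).re := by simp; linarith
  refine (re_levyFunction_mono h.nonneg_b hL (norm_nonneg z) ?_).trans (key _ hre)
  rw [Complex.norm_eq_sqrt_sq_add_sq, Complex.norm_eq_sqrt_sq_add_sq]
  apply Real.sqrt_le_sqrt
  simp
  nlinarith

end LevyFunction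

/-! ### Noninvertible operators -/

section Noninvertible

variable {X : Type*} [NormedAddCommGroup X] [NormedSpace ℂ X] [CompleteSpace X]

omit [CompleteSpace X] in
theorem exists_dual_ne_zero_vanishing_on_closed (p : Submodule ℂ X)
    (hp : IsClosed (p : Set X)) (h : p ≠ ⊤) : ∃ φ : X →L[ℂ] ℂ, φ ≠ 0 ∧ ∀ x ∈ p, φ x = 0 := by
  obtain ⟨v, hv⟩ : ∃ v, v ∉ p := by
    by_contra! hc
    exact h (Submodule.eq_top_iff'.2 hc)
  have : IsClosed (p : Set X) := hp
  obtain ⟨ψ, -, hψ⟩ := exists_dual_vector ℂ (p.mkQ v)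
    (by simpa [Submodule.Quotient.mk_eq_zero, norm_eq_zero] using hv)
  refine ⟨ψ.comp p.mkQL, fun h0 => ?_, fun x hx => ?_⟩
  · have h1 : ψ (p.mkQ v) = 0 := by simpa using! congrArg (fun f : X →L[ℂ] ℂ => f v) h0
    rw [hψ] at h1
    have h2 : ‖p.mkQ v‖ = 0 := by simpa using h1
    rw [norm_eq_zero] at h2
    exact hv ((Submodule.Quotient.mk_eq_zero p).1 h2)
  · have : p.mkQ x = 0 := (Submodule.Quotient.mk_eq_zero p).2 hx
    show ψ (p.mkQ x) = 0
    rw [this, _root_.map_zero]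

/-- An operator bounded below is injective with closed range. If it is still not invertible, the
range is proper and Hahn–Banach on the quotient gives an annihilating functional. -/
theorem exists_approx_kernel_or_dual_of_not_isUnit {Q : X →L[ℂ] X} (hQ : ¬ IsUnit Q) :
    (∀ δ : ℝ, 0 < δ → ∃ x, ‖x‖ = 1 ∧ ‖Q x‖ ≤ δ) ∨
      ∃ φ : X →L[ℂ] ℂ, φ ≠ 0 ∧ ∀ x, φ (Q x) = 0 := by
  by_contra! hc
  obtain ⟨⟨δ, hδ, hlow⟩, hdual⟩ := hc
  have hbound : ∀ x, δ * ‖x‖ ≤ ‖Q x‖ := fun x => by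
    rcases eq_or_ne x 0 with rfl | hx
    · simp
    have hx' : ‖x‖ ≠ 0 := norm_ne_zero_iff.2 hx
    have h1 := (hlow (((‖x‖ : ℂ)⁻¹) • x) (by simp [norm_smul, hx'])).le
    rw [map_smul, norm_smul, norm_inv, Complex.norm_real, norm_norm, inv_mul_eq_div,
      le_div_iff₀ (norm_pos_iff.2 hx)] at h1
    exact h1
  have hanti : AntilipschitzWith (Real.toNNReal δ⁻¹) Q :=
    ContinuousLinearMap.antilipschitz_of_bound Q fun x => by
      rw [Real.coe_toNNReal _ (by positivity), inv_mul_eq_div, le_div_iff₀ hδ, mul_comm]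
      exact hbound x
  have hclosed : IsClosed (Set.range Q) := hanti.isClosed_range Q.uniformContinuous
  refine hQ (ContinuousLinearMap.isUnit_iff_bijective.2 ⟨hanti.injective, ?_⟩)
  by_contra hs
  obtain ⟨φ, h0, hφ⟩ := exists_dual_ne_zero_vanishing_on_closed (LinearMap.range (Q : X →ₗ[ℂ] X))
    (by simpa using! hclosed) (fun ht => hs (LinearMap.range_eq_top.1 ht))
  obtain ⟨x, hx⟩ := hdual φ h0
  exact hx (hφ _ ⟨x, rfl⟩)

end Noninvertible

/-! ### Operators of the Hille–Phillips calculus -/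

namespace IsBoundedC0Semigroup

variable {X : Type*} [NormedAddCommGroup X] [NormedSpace ℂ X] {T : ℝ≥0 → X →L[ℂ] X}

theorem continuous_toNNReal (hT : IsBoundedC0Semigroup T) (x : X) :
    Continuous fun r : ℝ => T r.toNNReal x :=
  (hT.continuous x).comp continuous_real_toNNReal

theorem exists_bound (hT : IsBoundedC0Semigroup T) : ∃ M : ℝ, 0 ≤ M ∧ ∀ s, ‖T s‖ ≤ M := by
  obtain ⟨M, hM⟩ := hT.bounded
  exact ⟨M, (norm_nonneg _).trans (hM 0), hM⟩

theorem map_add_apply (hT : IsBoundedC0Semigroup T) (s t : ℝ≥0) (x : X) :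
    T (s + t) x = T s (T t x) := by rw [hT.map_add]; rfl

theorem comm_apply (hT : IsBoundedC0Semigroup T) (s t : ℝ≥0) (x : X) :
    T s (T t x) = T t (T s x) := by
  rw [← hT.map_add_apply, add_comm, hT.map_add_apply]

theorem integrableOn_smul (hT : IsBoundedC0Semigroup T) {k : ℝ → ℂ}
    (hk : IntegrableOn k (Set.Ioi 0)) (x : X) :
    IntegrableOn (fun r : ℝ => k r • T r.toNNReal x) (Set.Ioi 0) := by
  obtain ⟨M, hM0, hM⟩ := hT.exists_bound
  refine (hk.norm.mul_const (M * ‖x‖)).mono'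
    (hk.1.smul (hT.continuous_toNNReal x).aestronglyMeasurable) (.of_forall fun r => ?_)
  rw [norm_smul]
  gcongr
  exact (T _).le_of_opNorm_le (hM _) x

variable [CompleteSpace X]

omit [CompleteSpace X] in
theorem exists_kernelOperator (hT : IsBoundedC0Semigroup T) (b : ℂ) {k : ℝ → ℂ}
    (hk : IntegrableOn k (Set.Ioi 0)) : ∃ G : X →L[ℂ] X, ∀ x,
      G x = b • x + ∫ r in Set.Ioi (0 : ℝ), k r • T r.toNNReal x := by
  obtain ⟨M, hM0, hM⟩ := hT.exists_bound
  refine ⟨LinearMap.mkContinuous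
    { toFun := fun x => b • x + ∫ r in Set.Ioi (0 : ℝ), k r • T r.toNNReal x
      map_add' := fun x y => ?_
      map_smul' := fun c x => ?_ } (‖b‖ + (∫ r in Set.Ioi (0 : ℝ), ‖k r‖) * M) fun x => ?_,
    fun x => rfl⟩
  · simp only [_root_.map_add, smul_add]
    rw [integral_add (hT.integrableOn_smul hk x) (hT.integrableOn_smul hk y)]
    abel
  · simp only [_root_.map_smul, RingHom.id_apply, smul_add, smul_comm _ c]
    rw [integral_smul]
  · refine (norm_add_le _ _).trans ?_
    rw [norm_smul, add_mul, mul_assoc, ← integral_mul_const]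
    gcongr
    refine norm_integral_le_of_norm_le (hk.norm.mul_const _) (.of_forall fun r => ?_)
    rw [norm_smul]
    gcongr
    exact (T _).le_of_opNorm_le (hM _) x

/-- An operator commuting with the semigroup commutes with its strong integrals. -/
theorem kernelOperator_comm (hT : IsBoundedC0Semigroup T) {b : ℂ} {k : ℝ → ℂ}
    (hk : IntegrableOn k (Set.Ioi 0)) {G H : X →L[ℂ] X}
    (hG : ∀ x, G x = b • x + ∫ r in Set.Ioi (0 : ℝ), k r • T r.toNNReal x)
    (hH : ∀ s x, H (T s x) = T s (H x)) (x : X) : H (G x) = G (H x) := by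
  rw [hG, hG, _root_.map_add, _root_.map_smul,
    ← ContinuousLinearMap.integral_comp_comm H (hT.integrableOn_smul hk x)]
  simp only [_root_.map_smul, hH]

/-- Approximate characters are transformed by operators of the Hille–Phillips calculus according to
the Laplace transform. -/
theorem tendsto_kernelOperator (hT : IsBoundedC0Semigroup T) {b : ℂ} {k : ℝ → ℂ}
    (hk : IntegrableOn k (Set.Ioi 0)) {G : X →L[ℂ] X}
    (hG : ∀ x, G x = b • x + ∫ r in Set.Ioi (0 : ℝ), k r • T r.toNNReal x)
    {x : ℕ → X} {φ : ℕ → X →L[ℂ] ℂ} {B C : ℝ} (hx : ∀ n, ‖x n‖ ≤ B) (hφ : ∀ n, ‖φ n‖ ≤ C)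
    {lam c : ℂ}
    (h : ∀ s : ℝ, 0 ≤ s → Tendsto (fun n => φ n (T s.toNNReal (x n))) atTop
      (𝓝 (c * Complex.exp (-(s * lam))))) (s : ℝ) (hs : 0 ≤ s) :
    Tendsto (fun n => φ n (T s.toNNReal (G (x n)))) atTop
      (𝓝 (c * (b + ∫ r in Set.Ioi (0 : ℝ), Complex.exp (-(r * lam)) * k r) *
        Complex.exp (-(s * lam)))) := by
  obtain ⟨M, hM0, hM⟩ := hT.exists_bound
  have hC0 : 0 ≤ C := (norm_nonneg _).trans (hφ 0)
  have hB0 : 0 ≤ B := (norm_nonneg _).trans (hx 0)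
  have e : ∀ n, φ n (T s.toNNReal (G (x n))) = b * φ n (T s.toNNReal (x n)) +
      ∫ r in Set.Ioi (0 : ℝ), k r * φ n (T (s + r).toNNReal (x n)) := fun n => by
    rw [hT.kernelOperator_comm hk hG (fun r y => hT.comm_apply _ r y), hG, _root_.map_add,
      _root_.map_smul, ← ContinuousLinearMap.integral_comp_comm _ (hT.integrableOn_smul hk _)]
    congr 1
    refine setIntegral_congr_fun measurableSet_Ioi fun r hr => ?_
    rw [_root_.map_smul, smul_eq_mul, hT.comm_apply, ← hT.map_add_apply,
      Real.toNNReal_add hs (le_of_lt hr)]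
  simp only [e]
  have hlim : Tendsto (fun n => ∫ r in Set.Ioi (0 : ℝ), k r * φ n (T (s + r).toNNReal (x n))) atTop
      (𝓝 (∫ r in Set.Ioi (0 : ℝ), k r * (c * Complex.exp (-((s + r : ℝ) * lam))))) := by
    refine tendsto_integral_of_dominated_convergence (fun r => ‖k r‖ * (C * (M * B)))
      (fun n => hk.1.mul ?_) (hk.norm.mul_const _) (fun n => .of_forall fun r => ?_) ?_
    · exact ((φ n).continuous.comp ((hT.continuous_toNNReal (x n)).comp
        (continuous_const.add continuous_id))).aestronglyMeasurable
    · rw [norm_mul]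
      gcongr
      refine ((φ n).le_of_opNorm_le (hφ n) _).trans ?_
      gcongr
      refine ((T _).le_of_opNorm_le (hM _) _).trans ?_
      gcongr
      exact hx n
    · filter_upwards [ae_restrict_mem measurableSet_Ioi] with r hr
      exact (h (s + r) (add_nonneg hs (le_of_lt hr))).const_mul _
  convert ((h s hs).const_mul b).add hlim using 2
  have e2 : ∀ r : ℝ, k r * (c * Complex.exp (-((s + r : ℝ) * lam))) =
      c * Complex.exp (-(s * lam)) * (Complex.exp (-(r * lam)) * k r) := fun r => by
    rw [show -(((s + r : ℝ) : ℂ) * lam) = -(s * lam) + -(r * lam) by push_cast; ring,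
      Complex.exp_add]
    ring
  simp only [e2, integral_const_mul]
  ring

end IsBoundedC0Semigroup

/-! ### The resolvent at `-1` and the spectrum -/

theorem setIntegral_Ioi_comp_add_left {E : Type*} [NormedAddCommGroup E] [NormedSpace ℝ E]
    (f : ℝ → E) (s : ℝ) : ∫ r in Set.Ioi (0 : ℝ), f (s + r) = ∫ r in Set.Ioi s, f r := by
  rw [← integral_indicator measurableSet_Ioi, ← integral_indicator measurableSet_Ioi,
    ← integral_add_left_eq_self ((Set.Ioi s).indicator f) s]
  congr 1
  ext r
  simp [Set.indicator]

theorem integrableOn_cexp_neg : IntegrableOn (fun r : ℝ => Complex.exp (-r)) (Set.Ioi 0) := by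
  simpa using integrableOn_exp_mul_complex_Ioi (a := -1) (by simp) 0

namespace IsBoundedC0Semigroup

variable {X : Type*} [NormedAddCommGroup X] [NormedSpace ℂ X] [CompleteSpace X]
  {T : ℝ≥0 → X →L[ℂ] X} {R : X →L[ℂ] X}

/-- Substituting r ↦ r - s turns T(s)Rx into e^s times the tail of the integral beyond s. The
right-hand side makes sense for every real s, so it can be differentiated at 0 from both sides. -/
theorem apply_resolvent (hT : IsBoundedC0Semigroup T)
    (hR : ∀ x, R x = ∫ r in Set.Ioi (0 : ℝ), Complex.exp (-r) • T r.toNNReal x) (x : X) {s : ℝ}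
    (hs : 0 ≤ s) : T s.toNNReal (R x) =
      Complex.exp s • (R x - ∫ r in (0 : ℝ)..s, Complex.exp (-r) • T r.toNNReal x) := by
  have hi := hT.integrableOn_smul integrableOn_cexp_neg x
  have h1 : R x = (∫ r in (0 : ℝ)..s, Complex.exp (-r) • T r.toNNReal x) +
      ∫ r in Set.Ioi s, Complex.exp (-r) • T r.toNNReal x := by
    rw [hR, intervalIntegral.integral_of_le hs, ← Set.Ioc_union_Ioi_eq_Ioi hs]
    exact setIntegral_union Set.Ioc_disjoint_Ioi_same measurableSet_Ioi
      (hi.mono_set fun r hr => hr.1) (hi.mono_set (Set.Ioi_subset_Ioi hs))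
  rw [sub_eq_of_eq_add' h1, hR, ← ContinuousLinearMap.integral_comp_comm _ hi,
    ← setIntegral_Ioi_comp_add_left _ s, ← integral_smul]
  refine setIntegral_congr_fun measurableSet_Ioi fun r hr => ?_
  rw [_root_.map_smul, ← hT.map_add_apply, Real.toNNReal_add hs (le_of_lt hr), smul_smul,
    ← Complex.exp_add]
  congr 2
  push_cast
  ring

theorem hasDerivAt_resolvent (hT : IsBoundedC0Semigroup T) (x : X) (s : ℝ) : HasDerivAt
    (fun s : ℝ => Complex.exp s •
      (R x - ∫ r in (0 : ℝ)..s, Complex.exp (-r) • T r.toNNReal x))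
    (Complex.exp s • (R x - ∫ r in (0 : ℝ)..s, Complex.exp (-r) • T r.toNNReal x) -
      T s.toNNReal x) s := by
  have hc : Continuous fun r : ℝ => Complex.exp (-r) • T r.toNNReal x :=
    Continuous.smul (by fun_prop) (hT.continuous_toNNReal x)
  have h1 : HasDerivAt (fun s : ℝ => R x - ∫ r in (0 : ℝ)..s, Complex.exp (-r) • T r.toNNReal x)
      (-(Complex.exp (-s) • T s.toNNReal x)) s :=
    (hc.integral_hasStrictDerivAt 0 s).hasDerivAt.const_sub _
  have h2 : HasDerivAt (fun s : ℝ => Complex.exp s) (Complex.exp s) s :=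
    (Complex.hasDerivAt_exp s).comp_ofReal
  refine (h2.smul h1).congr_deriv ?_
  rw [smul_neg, smul_smul, ← Complex.exp_add, add_neg_cancel, Complex.exp_zero, one_smul]
  abel

/-- This is the identity (1 + A)R = 1, read off from the derivative at 0. -/
theorem tendsto_slope_resolvent (hT : IsBoundedC0Semigroup T)
    (hR : ∀ x, R x = ∫ r in Set.Ioi (0 : ℝ), Complex.exp (-r) • T r.toNNReal x) (x : X) :
    Tendsto (fun h : ℝ≥0 => (h : ℝ)⁻¹ • (R x - T h (R x))) (𝓝[>] 0) (𝓝 (x - R x)) := by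
  have h1 := hasDerivAt_iff_tendsto_slope_zero.1 (hT.hasDerivAt_resolvent (R := R) x 0)
  have ht : Tendsto (fun h : ℝ≥0 => (h : ℝ)) (𝓝[>] 0) (𝓝[≠] 0) := by
    refine tendsto_nhdsWithin_iff.2 ⟨?_, ?_⟩
    · exact (NNReal.continuous_coe.tendsto' 0 0 rfl).mono_left nhdsWithin_le_nhds
    · filter_upwards [self_mem_nhdsWithin] with h hh
      have : 0 < h := hh
      simpa using this.ne'
  have h2 := (h1.comp ht).neg
  simp only [Complex.ofReal_zero, Complex.exp_zero, intervalIntegral.integral_same, sub_zero,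
    one_smul, Real.toNNReal_zero, hT.map_zero, ContinuousLinearMap.id_apply, neg_sub] at h2
  refine h2.congr fun h => ?_
  have h3 := hT.apply_resolvent hR x h.2
  simp only [Function.comp_apply, zero_add]
  rw [← smul_neg, neg_sub]
  congr 2
  rw [← NNReal.val_eq_coe, ← h3]
  simp

theorem injective_resolvent (hT : IsBoundedC0Semigroup T)
    (hR : ∀ x, R x = ∫ r in Set.Ioi (0 : ℝ), Complex.exp (-r) • T r.toNNReal x) :
    Function.Injective R := by
  rw [injective_iff_map_eq_zero]
  intro x hx
  have := hT.tendsto_slope_resolvent hR x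
  simp only [hx, _root_.map_zero, sub_zero, smul_zero] at this
  exact (tendsto_nhds_unique this tendsto_const_nhds)

theorem resolvent_comm (hT : IsBoundedC0Semigroup T)
    (hR : ∀ x, R x = ∫ r in Set.Ioi (0 : ℝ), Complex.exp (-r) • T r.toNNReal x) {H : X →L[ℂ] X}
    (hH : ∀ s x, H (T s x) = T s (H x)) (x : X) : H (R x) = R (H x) :=
  hT.kernelOperator_comm (b := 0) integrableOn_cexp_neg (by simpa using hR) hH x

theorem resolvent_left_inverse (hT : IsBoundedC0Semigroup T)
    (hR : ∀ x, R x = ∫ r in Set.Ioi (0 : ℝ), Complex.exp (-r) • T r.toNNReal x) {x y : X}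
    (h : (x, y) ∈ (negGenerator T).graph) : R (x + y) = x := by
  rw [mem_graph_negGenerator] at h
  have h1 := (R.continuous.tendsto y).comp h
  have h2 : Tendsto (fun h : ℝ≥0 => (h : ℝ)⁻¹ • (R x - T h (R x))) (𝓝[>] 0) (𝓝 (R y)) := by
    refine h1.congr fun s => ?_
    simp only [Function.comp_apply]
    rw [R.map_smul_of_tower, _root_.map_sub,
      hT.resolvent_comm hR (H := T s) (fun r y => hT.comm_apply _ _ _) x]
  rw [_root_.map_add, tendsto_nhds_unique h2 (hT.tendsto_slope_resolvent hR x)]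
  abel

/-- On X one has (lam + 1)R - 1 = (lam - A)R, so an inverse V of this operator would make RV the
resolvent of A at lam. Spectral questions about A thus reduce to one bounded operator. -/
theorem not_isUnit_of_mem_opSpectrum (hT : IsBoundedC0Semigroup T)
    (hR : ∀ x, R x = ∫ r in Set.Ioi (0 : ℝ), Complex.exp (-r) • T r.toNNReal x) {lam : ℂ}
    (hlam : lam ∈ opSpectrum (negGenerator T)) : ¬ IsUnit ((lam + 1) • R - 1) := by
  rintro ⟨u, hu⟩
  obtain ⟨V, hV1, hV2⟩ : ∃ V : X →L[ℂ] X, (∀ x, (lam + 1) • R (V x) - V x = x) ∧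
      ∀ x, V ((lam + 1) • R x - x) = x := by
    refine ⟨(↑u⁻¹ : X →L[ℂ] X), fun x => ?_, fun x => ?_⟩
    · have := congrArg (fun f : X →L[ℂ] X => f x) u.mul_inv
      rwa [hu] at this
    · have := congrArg (fun f : X →L[ℂ] X => f x) u.inv_mul
      rwa [hu] at this
  refine hlam ⟨R.comp V, fun x => ?_, fun x => ?_⟩
  · have hg := (mem_graph_negGenerator T (R (V x), V x - R (V x))).2
      (hT.tendsto_slope_resolvent hR _)
    obtain ⟨y, hy1, hy2⟩ := (LinearPMap.mem_graph_iff _).1 hg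
    have hy3 : (y : X) = R (V x) := hy1
    have hmem : R (V x) ∈ (negGenerator T).domain := hy3 ▸ y.2
    have e : (⟨R (V x), hmem⟩ : (negGenerator T).domain) = y := Subtype.ext hy3.symm
    refine ⟨hmem, ?_⟩
    show lam • R (V x) - negGenerator T ⟨R (V x), hmem⟩ = x
    rw [e, hy2]
    refine Eq.trans ?_ (hV1 x)
    module
  · have h1 := hT.resolvent_left_inverse hR ((negGenerator T).mem_graph x)
    have h2 : lam • (x : X) - negGenerator T x =
        (lam + 1) • R (x + negGenerator T x) - (x + negGenerator T x) := by
      rw [h1, add_smul, one_smul]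
      abel
    rw [h2, ContinuousLinearMap.comp_apply, hV2, h1]

/-- The derivative of e^{lam u}T(u)Rx is e^{lam u}T(u)Qx with Q = (lam + 1)R - 1. -/
theorem exp_smul_apply_resolvent_sub (hT : IsBoundedC0Semigroup T)
    (hR : ∀ x, R x = ∫ r in Set.Ioi (0 : ℝ), Complex.exp (-r) • T r.toNNReal x) (lam : ℂ) (x : X)
    {s : ℝ} (hs : 0 ≤ s) : Complex.exp (lam * s) • T s.toNNReal (R x) - R x =
      ∫ u in (0 : ℝ)..s, Complex.exp (lam * u) • T u.toNNReal (((lam + 1) • R - 1) x) := by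
  have hd : ∀ u : ℝ, HasDerivAt (fun u : ℝ => Complex.exp (lam * u) • (Complex.exp u •
      (R x - ∫ r in (0 : ℝ)..u, Complex.exp (-r) • T r.toNNReal x)))
      (Complex.exp (lam * u) • ((lam + 1) • (Complex.exp u •
      (R x - ∫ r in (0 : ℝ)..u, Complex.exp (-r) • T r.toNNReal x)) - T u.toNNReal x)) u := by
    intro u
    have h1 : HasDerivAt (fun u : ℝ => Complex.exp (lam * u)) (Complex.exp (lam * u) * lam) u := by
      have := (((hasDerivAt_id (u : ℂ)).const_mul lam).cexp).comp_ofReal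
      simpa using this
    refine (h1.smul (hT.hasDerivAt_resolvent (R := R) x u)).congr_deriv ?_
    rw [mul_smul, ← smul_add, add_smul, one_smul]
    congr 1
    abel
  have hcongr : ∀ u ∈ Set.uIcc 0 s, HasDerivAt (fun u : ℝ => Complex.exp (lam * u) •
      (Complex.exp u • (R x - ∫ r in (0 : ℝ)..u, Complex.exp (-r) • T r.toNNReal x)))
      (Complex.exp (lam * u) • T u.toNNReal (((lam + 1) • R - 1) x)) u := fun u hu => by
    rw [Set.uIcc_of_le hs] at hu
    refine (hd u).congr_deriv ?_
    rw [← hT.apply_resolvent hR x hu.1]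
    simp
  have hcont : Continuous fun u : ℝ =>
      Complex.exp (lam * u) • T u.toNNReal (((lam + 1) • R - 1) x) :=
    Continuous.smul (by fun_prop) (hT.continuous_toNNReal _)
  rw [intervalIntegral.integral_eq_sub_of_hasDerivAt hcongr (hcont.intervalIntegrable 0 s),
    ← hT.apply_resolvent hR x hs]
  simp

/-- Substituting (lam + 1)R = 1 + Q in the previous identity removes R from the left side. The
defect from being an eigenvector of T(s) is thus controlled by Qx alone. -/
theorem exp_smul_apply_sub (hT : IsBoundedC0Semigroup T)
    (hR : ∀ x, R x = ∫ r in Set.Ioi (0 : ℝ), Complex.exp (-r) • T r.toNNReal x) (lam : ℂ) (x : X)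
    {s : ℝ} (hs : 0 ≤ s) : Complex.exp (lam * s) • T s.toNNReal x - x =
      (lam + 1) • (∫ u in (0 : ℝ)..s,
        Complex.exp (lam * u) • T u.toNNReal (((lam + 1) • R - 1) x)) -
      (Complex.exp (lam * s) • T s.toNNReal (((lam + 1) • R - 1) x) -
        ((lam + 1) • R - 1) x) := by
  rw [← hT.exp_smul_apply_resolvent_sub hR lam x hs]
  simp only [_root_.sub_apply, _root_.smul_apply, one_apply_eq_self, _root_.map_sub,
    _root_.map_smul, smul_sub]
  rw [smul_comm (lam + 1) (Complex.exp (lam * s))]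
  abel

/-- Every spectral value of `A` is an approximate character of the semigroup generated by `-A`. -/
theorem exists_approx_character (hT : IsBoundedC0Semigroup T) {lam : ℂ}
    (hlam : lam ∈ opSpectrum (negGenerator T)) :
    ∃ (x : ℕ → X) (φ : ℕ → X →L[ℂ] ℂ), (∀ n, ‖x n‖ ≤ 1) ∧ (∀ n, ‖φ n‖ ≤ 2) ∧
      ∀ s : ℝ, 0 ≤ s → Tendsto (fun n => φ n (T s.toNNReal (x n))) atTop
        (𝓝 (Complex.exp (-(s * lam)))) := by
  obtain ⟨M, hM0, hM⟩ := hT.exists_bound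
  obtain ⟨R, hR⟩ := hT.exists_kernelOperator 0 integrableOn_cexp_neg
  simp only [zero_smul, zero_add] at hR
  have key : ∀ s : ℝ, ∀ c : ℂ, c = Complex.exp (-(s * lam)) * (Complex.exp (lam * s) * c) :=
    fun s c => by
      rw [← mul_assoc, ← Complex.exp_add, show -((s : ℂ) * lam) + lam * s = 0 by ring,
        Complex.exp_zero, one_mul]
  -- Either unit vectors with Qxₙ → 0 are paired with norming functionals, or one functional
  -- annihilating ran Q is paired with a fixed vector; there it is an exact eigenfunctional of every
  -- T(s).
  rcases exists_approx_kernel_or_dual_of_not_isUnit (hT.not_isUnit_of_mem_opSpectrum hR hlam)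
    with h | ⟨φ, hφ0, hφ⟩
  · choose x hx1 hx2 using fun n : ℕ => h (1 / (n + 1)) (by positivity)
    have hx0 : ∀ n, ‖x n‖ ≠ 0 := fun n => by simp [hx1 n]
    choose φ hφ1 hφ2 using fun n => exists_dual_vector ℂ (x n) (hx0 n)
    refine ⟨x, φ, fun n => (hx1 n).le, fun n => by rw [hφ1 n]; norm_num, fun s hs => ?_⟩
    set Q : X →L[ℂ] X := (lam + 1) • R - 1 with hQ
    set D : ℝ := Real.exp (‖lam‖ * s) with hD
    have hexp : ∀ u : ℝ, 0 ≤ u → u ≤ s → ‖Complex.exp (lam * u)‖ ≤ D := fun u h0 hu => by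
      rw [Complex.norm_exp, hD]
      refine Real.exp_le_exp.2 ((Complex.re_le_norm _).trans ?_)
      rw [norm_mul, Complex.norm_real, Real.norm_of_nonneg h0]
      gcongr
    have hterm : ∀ n, ∀ u : ℝ, 0 ≤ u → u ≤ s →
        ‖Complex.exp (lam * u) • T u.toNNReal (Q (x n))‖ ≤ D * M * ‖Q (x n)‖ :=
      fun n u h0 hu => by
        rw [norm_smul, mul_assoc]
        exact mul_le_mul (hexp u h0 hu) ((T _).le_of_opNorm_le (hM _) _) (norm_nonneg _)
          (Real.exp_pos _).le
    set K : ℝ := ‖lam + 1‖ * (D * M * s) + (D * M + 1) with hK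
    have hbound : ∀ n, ‖Complex.exp (lam * s) • T s.toNNReal (x n) - x n‖ ≤ K * (1 / (n + 1)) := by
      intro n
      have hK0 : 0 ≤ K := by positivity
      refine le_trans ?_ (mul_le_mul_of_nonneg_left (hx2 n) hK0)
      rw [hT.exp_smul_apply_sub hR lam (x n) hs, hK, add_mul]
      refine (norm_sub_le _ _).trans (add_le_add ?_ ?_)
      · rw [norm_smul, mul_assoc]
        gcongr
        refine (intervalIntegral.norm_integral_le_of_norm_le_const
          (C := D * M * ‖Q (x n)‖) fun u hu => ?_).trans_eq ?_
        · rw [Set.uIoc_of_le hs] at hu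
          exact hterm n u hu.1.le hu.2
        · rw [sub_zero, abs_of_nonneg hs]
          ring
      · refine (norm_sub_le _ _).trans ?_
        rw [add_mul, one_mul]
        gcongr
        exact hterm n s hs le_rfl
    have h0 : Tendsto (fun n => φ n (Complex.exp (lam * s) • T s.toNNReal (x n) - x n)) atTop
        (𝓝 0) := by
      refine squeeze_zero_norm (a := fun n : ℕ => K * (1 / ((n : ℝ) + 1))) (fun n => ?_) ?_
      · refine ((φ n).le_of_opNorm_le (hφ1 n).le _).trans ?_
        rw [one_mul]
        exact hbound n
      · simpa using tendsto_one_div_add_atTop_nhds_zero_nat.const_mul K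
    have h1 := (h0.add_const 1).const_mul (Complex.exp (-(s * lam)))
    rw [zero_add, mul_one] at h1
    refine h1.congr fun n => ?_
    rw [_root_.map_sub, hφ2, hx1, _root_.map_smul, smul_eq_mul]
    simp only [RCLike.ofReal_one, sub_add_cancel]
    exact (key s _).symm
  -- Half the norm of φ is attained by |φ v| with ‖v‖ < 1; normalising to φ v = 1 costs a factor 2,
  -- the bound on the functionals.
  · obtain ⟨v, hv1, hv2⟩ := φ.exists_lt_apply_of_lt_opNorm
      (r := ‖φ‖ / 2) (half_lt_self (norm_pos_iff.2 hφ0))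
    have hv0 : φ v ≠ 0 := norm_pos_iff.1 ((by positivity : (0 : ℝ) ≤ ‖φ‖ / 2).trans_lt hv2)
    refine ⟨fun _ => v, fun _ => (φ v)⁻¹ • φ, fun _ => hv1.le, fun _ => ?_, fun s hs => ?_⟩
    · rw [norm_smul, norm_inv, inv_mul_eq_div, div_le_iff₀ (norm_pos_iff.2 hv0)]
      linarith
    · have hcomm : ∀ u x, φ (T u (((lam + 1) • R - 1) x)) = 0 := fun u x => by
        have : T u (((lam + 1) • R - 1) x) = ((lam + 1) • R - 1) (T u x) := by
          simp [hT.resolvent_comm hR (H := T u) (fun r y => hT.comm_apply _ _ _) x]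
        rw [this, hφ]
      have hcont : Continuous fun u : ℝ =>
          Complex.exp (lam * u) • T u.toNNReal (((lam + 1) • R - 1) v) :=
        Continuous.smul (by fun_prop) (hT.continuous_toNNReal _)
      have h1 := congrArg φ (hT.exp_smul_apply_sub hR lam v hs)
      rw [_root_.map_sub, _root_.map_sub, _root_.map_sub, hφ, _root_.map_smul, _root_.map_smul,
        _root_.map_smul, hcomm, ← ContinuousLinearMap.intervalIntegral_comp_comm _
        (hcont.intervalIntegrable 0 s)] at h1
      simp only [_root_.map_smul, hcomm, intervalIntegral.integral_zero, sub_zero,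
        smul_eq_mul, mul_zero, sub_eq_zero] at h1
      have h2 : φ (T s.toNNReal v) = Complex.exp (-(s * lam)) * φ v := by
        rw [← h1]
        exact key s _
      simp only [_root_.smul_apply, smul_eq_mul, h2]
      rw [mul_comm (Complex.exp _), inv_mul_cancel_left₀ hv0]
      exact tendsto_const_nhds

theorem re_nonneg_of_mem_opSpectrum (hT : IsBoundedC0Semigroup T) {lam : ℂ}
    (hlam : lam ∈ opSpectrum (negGenerator T)) : 0 ≤ lam.re := by
  obtain ⟨M, hM0, hM⟩ := hT.exists_bound
  obtain ⟨x, φ, hx, hφ, h⟩ := hT.exists_approx_character hlam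
  have hb : ∀ s : ℝ, 0 ≤ s → Real.exp (-(s * lam.re)) ≤ 2 * M := fun s hs => by
    have h1 := le_of_tendsto (h s hs).norm (b := 2 * (M * 1)) (.of_forall fun n => ?_)
    · rw [Complex.norm_exp] at h1
      simpa using h1
    · refine ((φ n).le_of_opNorm_le (hφ n) _).trans ?_
      gcongr
      refine ((T _).le_of_opNorm_le (hM _) _).trans ?_
      gcongr
      exact hx n
  by_contra! hc
  -- At this s the bound reads e^{2M} ≤ 2M, contradicting 1 + 2M ≤ e^{2M}.
  have h2 := hb (2 * M / -lam.re) (div_nonneg (by positivity) (by linarith))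
  have h3 : -(2 * M / -lam.re * lam.re) = 2 * M := by field_simp [hc.ne]
  rw [h3] at h2
  linarith [Real.add_one_le_exp (2 * M)]

/-- Spectral inclusion for products of two operators of the Hille–Phillips calculus. -/
theorem norm_laplace_mul_laplace_le (hT : IsBoundedC0Semigroup T) {lam : ℂ}
    (hlam : lam ∈ opSpectrum (negGenerator T)) {b c : ℂ} {k l : ℝ → ℂ}
    (hk : IntegrableOn k (Set.Ioi 0)) (hl : IntegrableOn l (Set.Ioi 0)) {G H : X →L[ℂ] X}
    (hG : ∀ x, G x = b • x + ∫ r in Set.Ioi (0 : ℝ), k r • T r.toNNReal x)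
    (hH : ∀ x, H x = c • x + ∫ r in Set.Ioi (0 : ℝ), l r • T r.toNNReal x) :
    ‖b + ∫ r in Set.Ioi (0 : ℝ), Complex.exp (-(r * lam)) * k r‖ *
      ‖c + ∫ r in Set.Ioi (0 : ℝ), Complex.exp (-(r * lam)) * l r‖ ≤ 2 * ‖H.comp G‖ := by
  obtain ⟨x, φ, hx, hφ, h⟩ := hT.exists_approx_character hlam
  have h1 := hT.tendsto_kernelOperator hk hG hx hφ (c := 1) (by simpa using h)
  -- The vectors G xₙ are again approximate characters, now with constant equal to the symbol of G
  -- at lam, so the transformation rule can be iterated for H.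
  have h2 := hT.tendsto_kernelOperator hl hH (x := fun n => G (x n)) (B := ‖G‖ * 1)
    (fun n => (G.le_opNorm _).trans (by gcongr; exact hx n)) hφ h1 0 le_rfl
  have h3 := le_of_tendsto h2.norm (b := 2 * (‖H.comp G‖ * 1)) (.of_forall fun n => ?_)
  · simpa using h3
  · rw [Real.toNNReal_zero, hT.map_zero]
    refine ((φ n).le_of_opNorm_le (hφ n) _).trans ?_
    gcongr
    exact ((H.comp G).le_opNorm (x n)).trans (by gcongr; exact hx n)

end IsBoundedC0Semigroup

/-! ### Cesàro means -/

/-- The density of the uniform distribution on `(0, t]`. -/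
noncomputable def cesaroKernel (t : ℝ) : ℝ → ℂ :=
  (Set.Ioc 0 t).indicator fun _ => ((t⁻¹ : ℝ) : ℂ)

theorem integrableOn_cesaroKernel (t : ℝ) : IntegrableOn (cesaroKernel t) (Set.Ioi 0) :=
  ((integrable_indicator_iff measurableSet_Ioc).2
    (integrableOn_const (by simp) (by simp))).integrableOn

theorem integral_cesaroKernel_smul {E : Type*} [NormedAddCommGroup E] [NormedSpace ℂ E] {t : ℝ}
    (ht : 0 ≤ t) (f : ℝ → E) :
    ∫ r in Set.Ioi (0 : ℝ), cesaroKernel t r • f r = t⁻¹ • ∫ r in (0 : ℝ)..t, f r := by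
  have e : (fun r => cesaroKernel t r • f r) =
      (Set.Ioc 0 t).indicator fun r => t⁻¹ • f r := by
    ext r
    by_cases hr : r ∈ Set.Ioc 0 t
    · rw [cesaroKernel, Set.indicator_of_mem hr, Set.indicator_of_mem hr, Complex.coe_smul]
    · rw [cesaroKernel, Set.indicator_of_notMem hr, Set.indicator_of_notMem hr, zero_smul]
  rw [e, setIntegral_indicator measurableSet_Ioc, Set.inter_eq_right.2 Set.Ioc_subset_Ioi_self,
    integral_smul, intervalIntegral.integral_of_le ht]

/-- On (0, t] the exponent has modulus at most 1/4, and |e^w - 1| ≤ 2|w| ≤ 1/2, so the mean of the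
exponentials is within 1/2 of 1. -/
theorem half_le_norm_laplace_cesaroKernel {t : ℝ} (ht : 0 < t) {z : ℂ} (hz : t * ‖z‖ ≤ 1 / 4) :
    1 / 2 ≤ ‖∫ r in Set.Ioi (0 : ℝ), Complex.exp (-(r * z)) * cesaroKernel t r‖ := by
  have h1 : ∫ r in Set.Ioi (0 : ℝ), Complex.exp (-(r * z)) * cesaroKernel t r =
      t⁻¹ • ∫ r in (0 : ℝ)..t, Complex.exp (-(r * z)) := by
    rw [← integral_cesaroKernel_smul ht.le]
    simp only [smul_eq_mul, mul_comm]
  have h2 : ‖∫ r in (0 : ℝ)..t, (Complex.exp (-(r * z)) - 1)‖ ≤ 1 / 2 * |t - 0| := by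
    refine intervalIntegral.norm_integral_le_of_norm_le_const fun r hr => ?_
    rw [Set.uIoc_of_le ht.le] at hr
    have h3 : ‖-((r : ℂ) * z)‖ ≤ 1 / 4 := by
      rw [norm_neg, norm_mul, Complex.norm_real, Real.norm_of_nonneg hr.1.le]
      exact (mul_le_mul_of_nonneg_right hr.2 (norm_nonneg z)).trans hz
    exact (Complex.norm_exp_sub_one_le (h3.trans (by norm_num))).trans (by linarith)
  have hc : Continuous fun r : ℝ => Complex.exp (-(r * z)) := by fun_prop
  rw [intervalIntegral.integral_sub (hc.intervalIntegrable 0 t) (by simp),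
    intervalIntegral.integral_const, sub_zero, abs_of_pos ht] at h2
  have h4 := norm_sub_norm_le (t • (1 : ℂ))
    (t • (1 : ℂ) - ∫ r in (0 : ℝ)..t, Complex.exp (-(r * z)))
  rw [sub_sub_cancel, norm_sub_rev (t • (1 : ℂ)), norm_smul, norm_one, mul_one,
    Real.norm_of_nonneg ht.le] at h4
  rw [h1, norm_smul, norm_inv, Real.norm_of_nonneg ht.le, inv_mul_eq_div, le_div_iff₀ ht]
  linarith

namespace IsBoundedC0Semigroup

variable {X : Type*} [NormedAddCommGroup X] [NormedSpace ℂ X] [CompleteSpace X]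
  {T : ℝ≥0 → X →L[ℂ] X}

/-- The range of the bounded operator `g(A)(1 + A)⁻¹` is contained in the range of `g(A)`. -/
theorem mem_extendedHPRange (hT : IsBoundedC0Semigroup T) {g : ℂ → ℂ} {a b : ℝ} {μ : Measure ℝ}
    (h : HasLevyTriple g a b μ) (hg : DifferentiableOn ℂ g {z : ℂ | 0 < z.re}) {G : X →L[ℂ] X}
    (hG : ∀ x, G x = (b : ℂ) • x + ∫ r in Set.Ioi (0 : ℝ), levyKernel a b μ r • T r.toNNReal x)
    (w : X) : G w ∈ extendedHPRange T g := by
  obtain ⟨R, hR⟩ := hT.exists_kernelOperator 0 integrableOn_cexp_neg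
  have hR' := hR
  simp only [zero_smul, zero_add] at hR'
  have hk := integrableOn_levyKernel a b h.isLevyMeasure
  have hν : hillePhillips T (kernelMeasure 0 fun r : ℝ => Complex.exp (-r)) = R := by
    ext x
    rw [hillePhillips_kernelMeasure hT 0 integrableOn_cexp_neg, hR]
  -- The regularizer is 1/(1+z), with operator R = (1 + A)⁻¹ and product symbol g(z)/(1+z); the
  -- preimage of G w under g(A) is R w.
  refine ⟨(R w, G w), ⟨kernelMeasure 0 fun r : ℝ => Complex.exp (-r),
    kernelMeasure b (levyKernel a b μ),
    ⟨isFiniteMeasure_variation_kernelMeasure _ integrableOn_cexp_neg,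
      isFiniteMeasure_variation_kernelMeasure _ hk, fun z hz => ?_, ?_⟩, ?_⟩, rfl⟩
  · rw [laplaceTransform_kernelMeasure _ hk hz.le,
      laplaceTransform_kernelMeasure _ integrableOn_cexp_neg hz.le,
      integral_exp_mul_levyKernel a b h.isLevyMeasure hz.le, h.eqOn hg hz]
    have e : ∀ r : ℝ, Complex.exp (-(r * z)) * Complex.exp (-r) = Complex.exp (-(1 + z) * r) :=
      fun r => by rw [← Complex.exp_add]; ring_nf
    simp only [e]
    rw [integral_exp_mul_complex_Ioi (by simp; linarith)]
    simp only [Complex.ofReal_zero, mul_zero, Complex.exp_zero, zero_add, neg_div_neg_eq]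
    rw [one_div, inv_mul_eq_div]
  · rw [hν]
    exact hT.injective_resolvent hR'
  · rw [hν, hillePhillips_kernelMeasure hT _ hk, ← hG]
    refine hT.resolvent_comm hR' (fun s x => ?_) w
    exact (hT.kernelOperator_comm hk hG (fun r y => hT.comm_apply _ _ _) x).symm

omit [CompleteSpace X] in
theorem exists_cesaroOperator (hT : IsBoundedC0Semigroup T) {t : ℝ} (ht : 0 ≤ t) :
    ∃ C : X →L[ℂ] X, (∀ x, C x = cesaroMean T t x) ∧
      ∀ x, C x = (0 : ℂ) • x + ∫ r in Set.Ioi (0 : ℝ), cesaroKernel t r • T r.toNNReal x := by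
  obtain ⟨C, hC⟩ := hT.exists_kernelOperator 0 (integrableOn_cesaroKernel t)
  refine ⟨C, fun x => ?_, hC⟩
  rw [hC, integral_cesaroKernel_smul ht, cesaroMean, zero_smul, zero_add]

end IsBoundedC0Semigroup

/-! ### Uniform boundedness and the contradiction. -/

theorem exists_levyTriple_of_tendsto {g : ℂ → ℂ}
    (hr : Tendsto (fun t : ℝ => t * bernsteinRate g t) atTop atTop) :
    ∃ (a b : ℝ) (μ : Measure ℝ), HasLevyTriple g a b μ ∧
      ∀ t, bernsteinRate g t = levyRate a b μ t := by
  by_cases h : ∃ p : ℝ × ℝ × Measure ℝ, HasLevyTriple g p.1 p.2.1 p.2.2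
  · exact ⟨_, _, _, h.choose_spec, fun t => by rw [bernsteinRate, dif_pos h]⟩
  -- Without a triple the rate has its default value 0, which is incompatible with t r(t) → ∞.
  · obtain ⟨t, ht⟩ := (hr.eventually_gt_atTop 0).exists
    rw [bernsteinRate, dif_neg h, mul_zero] at ht
    exact absurd ht (lt_irrefl _)

theorem exists_real_bound_of_iSup_ne_top {ι : Type*} [Nonempty ι] {f : ι → ℝ}
    (h : (⨆ i, (f i : EReal)) ≠ ⊤) : ∃ B : ℝ, ∀ i, f i ≤ B := by
  have hle : ∀ i, (f i : EReal) ≤ ⨆ i, (f i : EReal) := fun i => le_iSup (fun i => (f i : EReal)) i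
  have hbot : (⨆ i, (f i : EReal)) ≠ ⊥ := fun h0 => by
    have := hle (Classical.arbitrary ι)
    rw [h0, le_bot_iff] at this
    exact EReal.coe_ne_bot _ this
  refine ⟨(⨆ i, (f i : EReal)).toReal, fun i => ?_⟩
  have := hle i
  rwa [← EReal.coe_toReal h hbot, EReal.coe_le_coe_iff] at this

theorem mainTheorem2 {X : Type*} [NormedAddCommGroup X] [NormedSpace ℂ X] [CompleteSpace X]
    (g : ℂ → ℂ) (hg : IsSpecialBernstein g)
    (hr : Tendsto (fun t : ℝ => t * bernsteinRate g t) atTop atTop)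
    (T : ℝ≥0 → X →L[ℂ] X) (hT : IsBoundedC0Semigroup T)
    (hacc : AccPt (0 : ℂ) (𝓟 (opSpectrum (negGenerator T))))
    (ε : ℝ → ℝ) (hε_pos : ∀ t : ℝ, 0 < t → 0 < ε t)
    (hε_anti : AntitoneOn ε (Set.Ioi 0)) (hε_lim : Tendsto ε atTop (𝓝 0)) :
    ∃ y ∈ extendedHPRange T g,
      (⨆ t : Set.Ici (1 : ℝ),
        ((‖cesaroMean T (t : ℝ) y‖ / (ε (t : ℝ) * bernsteinRate g (t : ℝ)) : ℝ) : EReal)) = ⊤ := by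
  obtain ⟨a, b, μ, h, hrate⟩ := exists_levyTriple_of_tendsto hr
  simp only [hrate] at hr ⊢
  have hL := h.isLevyMeasure
  have hk := integrableOn_levyKernel a b hL
  -- For large t the rate is positive and bounded by 8 g(1/(4t)), which is at most 8 g(x) as soon as
  -- t ≥ 1/(4x).
  have hpos : ∀ x : ℝ, 0 < x → 0 < (levyFunction a b μ x).re := fun x hx => by
    obtain ⟨t, ht1, ht2⟩ := ((hr.eventually_gt_atTop 0).and
      (eventually_ge_atTop (1 / (4 * x)))).exists
    have ht0 : 0 < t := (by positivity : 0 < 1 / (4 * x)).trans_le ht2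
    have h1 := levyRate_le h.nonneg_a h.nonneg_b hL (x := 1 / (4 * t)) (by positivity)
    rw [show 1 / (4 * (1 / (4 * t))) = t by field_simp] at h1
    have h2 := re_levyFunction_mono (a := a) h.nonneg_b hL (s := 1 / (4 * t)) (t := x)
      (by positivity) (by
        rw [div_le_iff₀ (by positivity)] at ht2 ⊢
        linarith)
    linarith [pos_of_mul_pos_right ht1 ht0.le]
  obtain ⟨G, hG⟩ := hT.exists_kernelOperator b hk
  by_contra! hcon
  -- Only times with positive rate are indexed, so that the operators can be divided by ε(t) r(t).
  choose C hC1 hC2 using fun t : {t : ℝ // 1 ≤ t ∧ 0 < levyRate a b μ t} =>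
    hT.exists_cesaroOperator (zero_le_one.trans t.2.1)
  have hden : ∀ t : {t : ℝ // 1 ≤ t ∧ 0 < levyRate a b μ t}, 0 < ε t * levyRate a b μ t :=
    fun t => mul_pos (hε_pos t (zero_lt_one.trans_le t.2.1)) t.2.2
  obtain ⟨K, hK⟩ := banach_steinhaus
    (g := fun t : {t : ℝ // 1 ≤ t ∧ 0 < levyRate a b μ t} =>
      (((ε t * levyRate a b μ t)⁻¹ : ℝ) : ℂ) • (C t).comp G) fun w => by
    obtain ⟨B, hB⟩ := exists_real_bound_of_iSup_ne_top
      (hcon (G w) (hT.mem_extendedHPRange h hg.bernstein.holomorphic hG w))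
    refine ⟨B, fun t => ?_⟩
    refine le_trans (le_of_eq ?_) (hB ⟨t, t.2.1⟩)
    rw [_root_.smul_apply, ContinuousLinearMap.comp_apply, hC1, norm_smul, Complex.norm_real,
      Real.norm_of_nonneg (inv_pos.2 (hden t)).le, inv_mul_eq_div]
  -- The final estimate is r/256 ≤ 2Kεr, hence 512; |K| + 1 keeps the denominator positive.
  have hsmall : ∀ᶠ t in atTop, ε t < 1 / (512 * (|K| + 1)) :=
    hε_lim.eventually_lt_const (by positivity)
  obtain ⟨t₀, ht₀⟩ := eventually_atTop.1
    ((hsmall.and (hr.eventually_gt_atTop 0)).and (eventually_ge_atTop 1))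
  have ht₀1 : 1 ≤ t₀ := (ht₀ t₀ le_rfl).2
  -- The radius is chosen so that t = 1/(4|lam|) ≥ t₀; accumulation supplies lam ≠ 0.
  obtain ⟨lam, ⟨hlam0, hlam⟩, hlamt⟩ := ((accPt_iff_frequently.1 hacc).and_eventually
    (Metric.ball_mem_nhds (0 : ℂ) (show 0 < 1 / (4 * t₀) by positivity))).exists
  rw [dist_zero_right] at hlamt
  have hn : 0 < ‖lam‖ := norm_pos_iff.2 hlam0
  set t : ℝ := 1 / (4 * ‖lam‖) with ht
  have htt : t₀ ≤ t := by
    rw [ht, le_div_iff₀ (by positivity)]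
    rw [lt_div_iff₀ (by positivity)] at hlamt
    linarith
  obtain ⟨⟨hεt, hrt⟩, ht1⟩ := ht₀ t htt
  have ht0 : 0 < t := by positivity
  have hrt' : 0 < levyRate a b μ t := pos_of_mul_pos_right hrt ht0.le
  have hre := hT.re_nonneg_of_mem_opSpectrum hlam
  have hCG := hT.norm_laplace_mul_laplace_le hlam hk (integrableOn_cesaroKernel t) hG
    (hC2 ⟨t, ht1, hrt'⟩)
  have hces := half_le_norm_laplace_cesaroKernel ht0 (z := lam) (by rw [ht]; field_simp; norm_num)
  have hKt := hK ⟨t, ht1, hrt'⟩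
  have hd := hden ⟨t, ht1, hrt'⟩
  simp only at hKt hd
  rw [norm_smul, Complex.norm_real, Real.norm_of_nonneg (inv_pos.2 hd).le, inv_mul_eq_div,
    div_le_iff₀ hd] at hKt
  have hlow := norm_levyFunction_ge hg h hpos hre
  have hrl := levyRate_le h.nonneg_a h.nonneg_b hL hn
  rw [← ht] at hrl
  rw [integral_exp_mul_levyKernel a b hL hre, zero_add, norm_div] at hCG
  have hone : ‖1 + lam‖ ≤ 2 := by
    refine (norm_add_le _ _).trans ?_
    rw [norm_one]
    have : 1 / (4 * t₀) ≤ 1 := by rw [div_le_one (by positivity)]; linarith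
    linarith
  have hone0 : 0 < ‖1 + lam‖ := norm_pos_iff.2 (one_add_ne_zero_of_re_nonneg hre)
  -- Here 128 = 8 · 8 · 2: rate against g(|lam|), g(|lam|) against |g(lam)|, and |1 + lam| ≤ 2.
  have h1 : levyRate a b μ t / 128 ≤ ‖levyFunction a b μ lam‖ / ‖1 + lam‖ := by
    rw [le_div_iff₀ hone0]
    nlinarith
  have h2 : levyRate a b μ t / 128 * (1 / 2) ≤ 2 * (K * (ε t * levyRate a b μ t)) :=
    (mul_le_mul h1 hces (by norm_num) (by positivity)).trans (hCG.trans (by linarith))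
  rw [lt_div_iff₀ (by positivity)] at hεt
  have hεt0 := hε_pos t ht0
  have h3 : K * ε t ≤ (|K| + 1) * ε t := by
    have := le_abs_self K
    gcongr
    linarith
  nlinarith
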